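/- Let $(\mathcal V,\omega)$ be a real symplectic vector space of dimension $2g$, $\mathcal Z\subset\mathcal V$ a lattice that is self-dual for $\omega$, and $k$ a positive even integer. Over the torus $\mathcal T=\mathcal V/\mathcal Z$ let $\mathcal L$ be the quotient of $\mathcal V\times\mathbb C$ by the action $W\cdot(X,\lambda)=(X+W,e^{\pi i k\omega(W,X)}\lambda)$ of $\mathcal Z$, with the connection $d-2\pi i k\theta_0$, where $\theta_0(Y)=\frac12\omega(X,Y)$ at the point $X$. Let $\mathcal P$ be a rational Lagrangian subspace of $\mathcal V$, regarded as an invariant real polarization of $(\mathcal T,k\omega)$. The Hilbert space $\mathcal H_{\mathcal P}=\bigoplus_\Lambda S_\Lambda$ is the sum, over the Bohr–Sommerfeld leaves $\Lambda$ of $\mathcal P$ (those over which the flat connection has trivial holonomy), of the spaces $S_\Lambda$ of covariantly constant sections over $\Lambda$ of $\mathcal L\otimes|\mathrm{Det}\,\mathcal P^*|^{1/2}$, with inner product $\langle s\otimes\mu,s'\otimes\mu'\rangle=\int_\Lambda (s,s')\,\mu*\mu'$ on $S_\Lambda$ (hermitian products being conjugate linear in the first variable) and different $S_\Lambda$ orthogonal.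 For two polarizations, $F_{\mathcal P_2\mathcal P_1}:\mathcal H_{\mathcal P_1}\to\mathcal H_{\mathcal P_2}$ is the operator with $\langle\psi_2,F_{\mathcal P_2\mathcal P_1}\psi_1\rangle=\langle\langle\psi_2,\psi_1\rangle\rangle$, where $\langle\langle s_2\otimes\mu_2,s_1\otimes\mu_1\rangle\rangle=\int_{\Lambda_2\cap\Lambda_1}(s_2,s_1)\,\mu_2*\mu_1$ is the Blattner–Kostant–Sternberg pairing with respect to $k\omega$. The group $Sp(\mathcal Z)$ of linear symplectic automorphisms of $\mathcal V$ preserving $\mathcal Z$ acts on $\mathcal L$ by $b\cdot(X,\lambda)=(bX,\lambda)$ and on half-densities by transport, which gives operators $b:\mathcal H_{\mathcal P}\to\mathcal H_{b\mathcal P}$; the projective representation of $Sp(\mathcal Z)$ on $\mathcal H_{\mathcal P}$ is given by $U_{\mathcal P}(b)=F_{\mathcal P,b\mathcal P}\circ b$. Let $(W_1,\dots,W_g;W_1^\perp,\dots,W_g^\perp)$ be a symplectic basis of $(\mathcal V,\omega)$, with $\omega(W_i,W_j^\perp)=\delta_{ij}$, that is a $\mathbb Z$-basis of $\mathcal Z$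 and satisfies $\mathcal P=\mathrm{span}_{\mathbb R}\{W_1,\dots,W_g\}$. For $\mathbf q\in(\mathbb Z/k\mathbb Z)^g$ let $\sigma_{\mathbf q}=s_{\mathbf q}\otimes\delta_{\mathbf q}$ be the section over the leaf $\Lambda_{\mathbf q}:\ k\,\omega(W_i,X)\equiv q_i\pmod k$, $i=1,\dots,g$, where $s_{\mathbf q}$ is represented on $\mathcal V$ by $e^{-2\pi i kK(X)}$ with $K(X)=\frac12\sum_i\omega(W_i,X)\,\omega(X,W_i^\perp)$, and $\delta_{\mathbf q}$ is the half-density with $\delta_{\mathbf q}(W_1,\dots,W_g)=1$. Then $\{\sigma_{\mathbf q}\}$ is a unitary basis of $\mathcal H_{\mathcal P}$. Moreover, for the elements of $Sp(\mathcal Z)$ with matrices $$\alpha=\begin{pmatrix}A&0\\0&{}^tA^{-1}\end{pmatrix},\qquad \beta=\begin{pmatrix}I&B\\0&I\end{pmatrix},\qquad \gamma=\begin{pmatrix}0&I\\-I&0\end{pmatrix}$$ in this basis, with $A\in GL(g,\mathbb Z)$ and $B\in M(g,\mathbb Z)$, ${}^tB=B$, the operators $U_{\mathcal P}(\alpha)$,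 $U_{\mathcal P}(\beta)$, $U_{\mathcal P}(\gamma)$ are well defined and unitary, and for all $\mathbf q\in(\mathbb Z/k\mathbb Z)^g$ $$U_{\mathcal P}(\alpha)\,\sigma_{\mathbf q}=\sigma_{{}^tA^{-1}\mathbf q},\qquad U_{\mathcal P}(\beta)\,\sigma_{\mathbf q}=e^{\frac{\pi i}{k}{}^t\mathbf qB\mathbf q}\,\sigma_{\mathbf q},\qquad U_{\mathcal P}(\gamma)\,\sigma_{\mathbf q}=k^{-g/2}\sum_{\mathbf q_1\in(\mathbb Z/k\mathbb Z)^g}e^{\frac{2\pi i}{k}{}^t\mathbf q\mathbf q_1}\,\sigma_{\mathbf q_1}.$$ -/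

import Mathlib

open scoped Matrix

noncomputable section

namespace TorusQuantization

/-- A symplectic vector space `(V, ω)` of dimension `2g` with a self-dual lattice `Z`, and a level
`k`, a positive even integer.  It stands for the symplectic torus `(V / Z, k ω)`. -/
structure SymplecticTorus (g : ℕ) (V : Type*) [AddCommGroup V] [Module ℝ V] where
  /-- the symplectic form -/
  ω : LinearMap.BilinForm ℝ V
  ω_alt : ω.IsAlt
  ω_nondegenerate : ω.Nondegenerate
  /-- the lattice -/
  Z : Submodule ℤ V
  Z_lattice : ∃ b : Module.Basis (Fin (2 * g)) ℝ V, Z = Submodule.span ℤ (Set.range b)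
  Z_selfDual : ∀ X : V, X ∈ Z ↔ ∀ W ∈ Z, ∃ n : ℤ, ω X W = n
  /-- the level -/
  k : ℕ
  k_pos : 0 < k
  k_even : Even k

/-- For a linear subspace `L`, the complex line `ℂ ⊗ |Det L*|^{1/2}` of complex multiples of
half-densities on the `g`-dimensional space `L`: maps `ν` on `g`-tuples of vectors of `L` with
`ν (a v₁, …, a v_g) = |det a|^{1/2} ν (v₁, …, v_g)` for all `a ∈ GL(L)`. -/
def HalfDensity (g : ℕ) {V : Type*} [AddCommGroup V] [Module ℝ V] (L : Submodule ℝ V) :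
    Submodule ℂ ((Fin g → L) → ℂ) where
  carrier := {ν | ∀ (a : L ≃ₗ[ℝ] L) (v : Fin g → L),
    ν (fun i => a (v i)) = (Real.sqrt |LinearMap.det (a : L →ₗ[ℝ] L)| : ℂ) * ν v}
  add_mem' := by
    intro μ ν hμ hν a v
    simp only [Pi.add_apply, hμ a v, hν a v, mul_add]
  zero_mem' := by
    intro a v
    simp
  smul_mem' := by
    intro c ν hν a v
    simp only [Pi.smul_apply, smul_eq_mul, hν a v]
    ring

/-- A linear isomorphism carries half-densities on `L` to half-densities on `L'`, by
`(e ν) (e v₁, …, e v_g) = ν (v₁, …, v_g)`. -/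
def HalfDensity.map {g : ℕ} {V : Type*} [AddCommGroup V] [Module ℝ V] {L L' : Submodule ℝ V}
    (e : L ≃ₗ[ℝ] L') : HalfDensity g L →ₗ[ℂ] HalfDensity g L' where
  toFun ν := ⟨fun v => ν.1 (fun i => e.symm (v i)), by
    intro a v
    have h := ν.2 ((e.trans a).trans e.symm) (fun i => e.symm (v i))
    have hdet : LinearMap.det (((e.trans a).trans e.symm : L ≃ₗ[ℝ] L) : L →ₗ[ℝ] L) =
        LinearMap.det (a : L' →ₗ[ℝ] L') := by
      rw [← LinearMap.det_conj (a : L' →ₗ[ℝ] L') e.symm]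
      rfl
    rw [hdet] at h
    simpa using h⟩
  map_add' μ ν := rfl
  map_smul' c ν := rfl

namespace SymplecticTorus

variable {g : ℕ} {V : Type*} [AddCommGroup V] [Module ℝ V] (S : SymplecticTorus g V)

instance : NeZero S.k := ⟨S.k_pos.ne'⟩

/-- An invariant real polarization of the torus: a rational Lagrangian subspace of `V`. -/
structure Polarization where
  /-- the Lagrangian subspace -/
  L : Submodule ℝ V
  isotropic : ∀ X ∈ L, ∀ Y ∈ L, S.ω X Y = 0
  finrank_eq : Module.finrank ℝ L = g
  rational : Submodule.span ℝ ((S.Z : Set V) ∩ (L : Set V)) = L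

/-- The group `Sp(Z)` of linear symplectic automorphisms of `V` that preserve the lattice. -/
def SpZ : Subgroup (V ≃ₗ[ℝ] V) where
  carrier := {b | (∀ X Y, S.ω (b X) (b Y) = S.ω X Y) ∧ ∀ X, b X ∈ S.Z ↔ X ∈ S.Z}
  mul_mem' := by
    rintro a b ⟨ha, ha'⟩ ⟨hb, hb'⟩
    refine ⟨fun X Y => ?_, fun X => ?_⟩
    · rw [LinearEquiv.mul_apply, LinearEquiv.mul_apply, ha, hb]
    · rw [LinearEquiv.mul_apply, ha', hb']
  one_mem' := ⟨fun _ _ => rfl, fun _ => Iff.rfl⟩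
  inv_mem' := by
    rintro a ⟨ha, ha'⟩
    refine ⟨fun X Y => ?_, fun X => ?_⟩
    · have h := ha (a.symm X) (a.symm Y)
      rw [a.apply_symm_apply, a.apply_symm_apply] at h
      exact h.symm
    · have h := ha' (a.symm X)
      rw [a.apply_symm_apply] at h
      exact h.symm

/-- The polarization `b P`, with Lagrangian subspace `b L`. -/
def Polarization.map {S : SymplecticTorus g V} (b : S.SpZ) (P : S.Polarization) :
    S.Polarization where
  L := P.L.map ((b : V ≃ₗ[ℝ] V) : V →ₗ[ℝ] V)
  isotropic := by
    rintro _ ⟨X, hX, rfl⟩ _ ⟨Y, hY, rfl⟩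
    exact (b.2.1 X Y).trans (P.isotropic X hX Y hY)
  finrank_eq := by
    exact (LinearEquiv.finrank_map_eq (b : V ≃ₗ[ℝ] V) P.L).trans P.finrank_eq
  rational := by
    conv_rhs => rw [← P.rational]
    rw [Submodule.map_span]
    congr 1
    ext X
    constructor
    · rintro ⟨hZ, Y, hY, rfl⟩
      exact ⟨Y, ⟨(b.2.2 Y).1 hZ, hY⟩, rfl⟩
    · rintro ⟨Y, ⟨hZ, hY⟩, rfl⟩
      exact ⟨(b.2.2 Y).2 hZ, Y, hY, rfl⟩

/-- For a linear subspace `D`, the set `V / (Z + D)` of translates of the image of `D` in the torus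
`V / Z`.  The class of `X` is the translate through the point of the torus below `X`. -/
abbrev Leaf (D : Submodule ℝ V) : Type _ := V ⧸ (S.Z.toAddSubgroup ⊔ D.toAddSubgroup)

/-- The class of `X` in `V / (Z + D)`. -/
def leaf (D : Submodule ℝ V) (X : V) : S.Leaf D := QuotientAddGroup.mk X

/-- The space `S_Λ` of covariantly constant sections over the leaf `Λ` of the polarization `P`, of
the tensor product of the prequantum line bundle with the bundle of half-densities of `P`.
The prequantum line bundle is the quotient of `V × ℂ` by the lattice, which acts by
`W · (X, c) = (X + W, e^{π i k ω(W, X)} c)`, so that a section over `Λ` is a lattice-invariant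
section over the preimage of `Λ` in `V`; it is extended by `0` to all of `V`.
The connection is `∇ = d - 2π i k θ₀` with `θ₀(Y) = ω(X, Y) / 2` at the point `X`, and half-densities
are differentiated along `P` through their values on constant frames. -/
def leafSections (P : S.Polarization) (Λ : S.Leaf P.L) :
    Submodule ℂ (V → HalfDensity g P.L) where
  carrier := {ψ |
    (∀ X, S.leaf P.L X ≠ Λ → ψ X = 0) ∧
    (∀ W ∈ S.Z, ∀ X, ψ (X + W) =
      Complex.exp (Real.pi * Complex.I * S.k * (S.ω W X : ℝ)) • ψ X) ∧
    (∀ X, ∀ Y ∈ P.L, ∀ v, HasDerivAt (fun t : ℝ => (ψ (X + t • Y)).1 v)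
      (2 * Real.pi * Complex.I * S.k * ((1 / 2 * S.ω X Y : ℝ) : ℂ) * (ψ X).1 v) 0)}
  add_mem' := by
    rintro φ ψ ⟨h1, h2, h3⟩ ⟨h1', h2', h3'⟩
    refine ⟨fun X hX => ?_, fun W hW X => ?_, fun X Y hY v => ?_⟩
    · simp [h1 X hX, h1' X hX]
    · simp only [Pi.add_apply, h2 W hW X, h2' W hW X, smul_add]
    · have h := (h3 X Y hY v).add (h3' X Y hY v)
      rw [← mul_add] at h
      exact h
  zero_mem' := by
    refine ⟨fun X _ => rfl, fun W _ X => by simp, fun X Y _ v => ?_⟩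
    have h := hasDerivAt_const (0 : ℝ) (0 : ℂ)
    simpa using h
  smul_mem' := by
    rintro c ψ ⟨h1, h2, h3⟩
    refine ⟨fun X hX => ?_, fun W hW X => ?_, fun X Y hY v => ?_⟩
    · simp [h1 X hX]
    · simp only [Pi.smul_apply, h2 W hW X]
      rw [smul_comm]
    · have h := (h3 X Y hY v).const_mul c
      rw [mul_left_comm] at h
      exact h

/-- The Bohr–Sommerfeld leaves: those over which there is a nowhere zero covariantly constant
section, that is, over which the flat connection has trivial holonomy. -/
def bohrSommerfeld (P : S.Polarization) : Set (S.Leaf P.L) :=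
  {Λ | ∃ ψ ∈ S.leafSections P Λ, ∀ X, S.leaf P.L X = Λ → ψ X ≠ 0}

/-- The space of quantization `H_P = ⨁ S_Λ`, the sum over the Bohr–Sommerfeld leaves `Λ`.  The sum
is direct, because sections over different leaves have disjoint supports. -/
def H (P : S.Polarization) : Submodule ℂ (V → HalfDensity g P.L) :=
  ⨆ Λ ∈ S.bohrSommerfeld P, S.leafSections P Λ

/-- The sum, over all translates `c` of the torus `D / (Z ∩ D)` in `V / Z`, of the integral over `c`
of the density whose value at `X` on the frame `w` of `D` is `f X`.  Here `w` has to be a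
`ℤ`-basis of `Z ∩ D`, and `f` invariant under the lattice. -/
def integral {ι : Type} [Fintype ι] (D : Submodule ℝ V) (w : ι → V) (f : V → ℂ) : ℂ :=
  ∑ᶠ c : S.Leaf D, ∫ t in Set.Icc (0 : ι → ℝ) 1, f (Quotient.out c + ∑ i, t i • w i)

/-- `w` is a frame of the Lagrangian subspace of `P`, and a `ℤ`-basis of its lattice points. -/
structure IsLatticeFrame (P : S.Polarization) (w : Fin g → P.L) : Prop where
  linearIndependent : LinearIndependent ℝ w
  span_eq : Submodule.span ℤ (Set.range fun i => (w i : V)) = S.Z ⊓ P.L.restrictScalars ℤ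

/-- A choice of lattice frame. The integrals below do not depend on it. -/
def latticeFrame (P : S.Polarization) : Fin g → P.L :=
  Classical.epsilon (S.IsLatticeFrame P)

/-- The inner product of `H_P` (conjugate linear in the first variable): the sum over all leaves
`Λ` of the integral over `Λ` of the density `(s, s') μ * μ'`, for sections `s ⊗ μ`, `s' ⊗ μ'`. -/
def innerH (P : S.Polarization) (ψ φ : S.H P) : ℂ :=
  S.integral P.L (fun i => (S.latticeFrame P i : V)) fun X =>
    (starRingEnd ℂ) ((ψ.1 X).1 (S.latticeFrame P)) * (φ.1 X).1 (S.latticeFrame P)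

/-- The number `h = g - dim (P₁ ∩ P₂)`. -/
def codim (P₂ P₁ : S.Polarization) : ℕ := g - Module.finrank ℝ ↥(P₂.L ⊓ P₁.L)

/-- Frames `U₂ = (V₂, W)` of `P₂` and `U₁ = (V₁, W)` of `P₁` and vectors `T` as in the definition of
the product of half-densities of two polarizations.  Indices `i < h` belong to `V₂` and `V₁`, and
indices `j ≥ h` to `W` and `T`; the vectors `T j` with `j < h` play no role.
The common part `W` is moreover a `ℤ`-basis of the lattice points of `P₁ ∩ P₂`. -/
structure IsAdaptedFrame (P₂ P₁ : S.Polarization) (U₂ : Fin g → P₂.L) (U₁ : Fin g → P₁.L)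
    (T : Fin g → V) : Prop where
  linearIndependent₂ : LinearIndependent ℝ U₂
  linearIndependent₁ : LinearIndependent ℝ U₁
  common : ∀ j : Fin g, S.codim P₂ P₁ ≤ j → (U₂ j : V) = U₁ j
  span_eq : Submodule.span ℤ ((fun j => (U₂ j : V)) '' {j | S.codim P₂ P₁ ≤ j}) =
    S.Z ⊓ (P₂.L ⊓ P₁.L).restrictScalars ℤ
  W_T : ∀ i j : Fin g, S.codim P₂ P₁ ≤ i → S.codim P₂ P₁ ≤ j →
    S.k * S.ω (U₂ i) (T j) = if i = j then 1 else 0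
  V₂_V₁ : ∀ i j : Fin g, (i : ℕ) < S.codim P₂ P₁ → (j : ℕ) < S.codim P₂ P₁ →
    S.k * S.ω (U₂ i) (U₁ j) = if i = j then 1 else 0
  V₁_T : ∀ i j : Fin g, (i : ℕ) < S.codim P₂ P₁ → S.codim P₂ P₁ ≤ j →
    S.k * S.ω (U₁ i) (T j) = 0
  V₂_T : ∀ i j : Fin g, (i : ℕ) < S.codim P₂ P₁ → S.codim P₂ P₁ ≤ j →
    S.k * S.ω (U₂ i) (T j) = 0

/-- A choice of adapted frames `(U₂, U₁, T)`.  The pairing below does not depend on it. -/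
def adaptedFrame (P₂ P₁ : S.Polarization) :
    (Fin g → P₂.L) × (Fin g → P₁.L) × (Fin g → V) :=
  Classical.epsilon fun F => S.IsAdaptedFrame P₂ P₁ F.1 F.2.1 F.2.2

/-- The Blattner–Kostant–Sternberg pairing of `H_{P₂}` and `H_{P₁}`: the sum over the leaves
`Λ₂`, `Λ₁` of the integral over `Λ₂ ∩ Λ₁` of the density `(s₂, s₁) μ₂ * μ₁`, for sections
`s₂ ⊗ μ₂` and `s₁ ⊗ μ₁`, where `(μ₂ * μ₁)(W) = μ₂(U₂) μ₁(U₁)`.  The sets `Λ₂ ∩ Λ₁` are disjoint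
unions of translates of the image of `P₂ ∩ P₁`, and the integrand vanishes on a translate that is
not contained in the intersection of two Bohr–Sommerfeld leaves. -/
def bksPairing (P₂ P₁ : S.Polarization) (ψ₂ : S.H P₂) (ψ₁ : S.H P₁) : ℂ :=
  S.integral (P₂.L ⊓ P₁.L)
    (fun j : {j : Fin g // S.codim P₂ P₁ ≤ j} => ((S.adaptedFrame P₂ P₁).1 j : V))
    fun X => (starRingEnd ℂ) ((ψ₂.1 X).1 (S.adaptedFrame P₂ P₁).1) *
      (ψ₁.1 X).1 (S.adaptedFrame P₂ P₁).2.1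

/-- `F : H_{P₁} → H_{P₂}` is the operator induced by the pairing: `⟨ψ₂, F ψ₁⟩ = ⟪ψ₂, ψ₁⟫`. -/
def IsIntertwiner (P₂ P₁ : S.Polarization) (F : S.H P₁ →ₗ[ℂ] S.H P₂) : Prop :=
  ∀ (ψ₂ : S.H P₂) (ψ₁ : S.H P₁), S.innerH P₂ ψ₂ (F ψ₁) = S.bksPairing P₂ P₁ ψ₂ ψ₁

/-- The operator `F_{P₂ P₁} : H_{P₁} → H_{P₂}` induced by the pairing. -/
def intertwiner (P₂ P₁ : S.Polarization) : S.H P₁ →ₗ[ℂ] S.H P₂ :=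
  Classical.epsilon (S.IsIntertwiner P₂ P₁)

/-- The restriction of `b ∈ Sp(Z)` to an isomorphism from `P` to `b P`. -/
def restrict (b : S.SpZ) (P : S.Polarization) : P.L ≃ₗ[ℝ] (P.map b).L :=
  (b : V ≃ₗ[ℝ] V).submoduleMap P.L

/-- The action of `b ∈ Sp(Z)` on sections, `(b ψ)(X) = b (ψ (b⁻¹ X))`.  The lift to the prequantum
line bundle is `b (X, c) = (b X, c)`, and half-densities are transported by `b`. -/
def actFun (b : S.SpZ) (P : S.Polarization) :
    (V → HalfDensity g P.L) →ₗ[ℂ] (V → HalfDensity g (P.map b).L) where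
  toFun ψ X := HalfDensity.map (S.restrict b P) (ψ ((b : V ≃ₗ[ℝ] V).symm X))
  map_add' φ ψ := by
    funext X
    simp
  map_smul' c ψ := by
    funext X
    simp

theorem leaf_eq_iff (D : Submodule ℝ V) (X Y : V) :
    S.leaf D X = S.leaf D Y ↔ ∃ W ∈ S.Z, ∃ U ∈ D, X + W + U = Y := by
  unfold leaf
  rw [QuotientAddGroup.eq, AddSubgroup.mem_sup]
  constructor
  · rintro ⟨W, hW, U, hU, h⟩
    refine ⟨W, hW, U, hU, ?_⟩
    rw [add_assoc, h]
    abel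
  · rintro ⟨W, hW, U, hU, h⟩
    refine ⟨W, hW, U, hU, ?_⟩
    rw [← h]
    abel

theorem leaf_map_iff (b : S.SpZ) (P : S.Polarization) (X Y : V) :
    S.leaf (P.map b).L X = S.leaf (P.map b).L ((b : V ≃ₗ[ℝ] V) Y) ↔
      S.leaf P.L ((b : V ≃ₗ[ℝ] V).symm X) = S.leaf P.L Y := by
  rw [leaf_eq_iff, leaf_eq_iff]
  constructor
  · rintro ⟨W, hW, _, ⟨U, hU, rfl⟩, h⟩
    refine ⟨(b : V ≃ₗ[ℝ] V).symm W, ?_, U, hU, ?_⟩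
    · rw [← b.2.2, LinearEquiv.apply_symm_apply]
      exact hW
    · apply (b : V ≃ₗ[ℝ] V).injective
      rw [← h]
      simp
  · rintro ⟨W, hW, U, hU, h⟩
    refine ⟨(b : V ≃ₗ[ℝ] V) W, (b.2.2 W).2 hW, (b : V ≃ₗ[ℝ] V) U, ⟨U, hU, rfl⟩, ?_⟩
    rw [← h]
    simp

theorem ω_symm_apply (b : S.SpZ) (X Y : V) :
    S.ω ((b : V ≃ₗ[ℝ] V).symm X) ((b : V ≃ₗ[ℝ] V).symm Y) = S.ω X Y := by
  have h := b.2.1 ((b : V ≃ₗ[ℝ] V).symm X) ((b : V ≃ₗ[ℝ] V).symm Y)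
  rw [LinearEquiv.apply_symm_apply, LinearEquiv.apply_symm_apply] at h
  exact h.symm

theorem actFun_mem_leafSections (b : S.SpZ) (P : S.Polarization) (Y₀ : V)
    {ψ : V → HalfDensity g P.L} (hψ : ψ ∈ S.leafSections P (S.leaf P.L Y₀)) :
    S.actFun b P ψ ∈ S.leafSections (P.map b)
      (S.leaf (P.map b).L ((b : V ≃ₗ[ℝ] V) Y₀)) := by
  obtain ⟨h1, h2, h3⟩ := hψ
  refine ⟨fun X hX => ?_, fun W hW X => ?_, fun X Y hY v => ?_⟩
  · have h := h1 ((b : V ≃ₗ[ℝ] V).symm X) (fun h => hX ((S.leaf_map_iff b P X Y₀).2 h))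
    simp [actFun, h]
  · have hW' : (b : V ≃ₗ[ℝ] V).symm W ∈ S.Z := by
      rw [← b.2.2, LinearEquiv.apply_symm_apply]
      exact hW
    have h := h2 _ hW' ((b : V ≃ₗ[ℝ] V).symm X)
    rw [S.ω_symm_apply] at h
    simp only [actFun, LinearMap.coe_mk, AddHom.coe_mk, map_add, h, map_smul]
  · have hY' : (b : V ≃ₗ[ℝ] V).symm Y ∈ P.L := by
      obtain ⟨U, hU, rfl⟩ := hY
      simpa using hU
    have h := h3 ((b : V ≃ₗ[ℝ] V).symm X) _ hY' (fun i => (S.restrict b P).symm (v i))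
    rw [S.ω_symm_apply] at h
    simpa [actFun, HalfDensity.map] using h

theorem actFun_mem_H (b : S.SpZ) (P : S.Polarization) {ψ : V → HalfDensity g P.L}
    (hψ : ψ ∈ S.H P) : S.actFun b P ψ ∈ S.H (P.map b) := by
  have key : S.H P ≤ (S.H (P.map b)).comap (S.actFun b P) := by
    refine iSup₂_le fun Λ hΛ φ hφ => ?_
    obtain ⟨Y₀, rfl⟩ := QuotientAddGroup.mk_surjective Λ
    obtain ⟨χ, hχ, hne⟩ := hΛ
    refine Submodule.mem_iSup_of_mem (S.leaf (P.map b).L ((b : V ≃ₗ[ℝ] V) Y₀)) ?_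
    refine Submodule.mem_iSup_of_mem ?_ (S.actFun_mem_leafSections b P Y₀ hφ)
    refine ⟨_, S.actFun_mem_leafSections b P Y₀ hχ, fun X hX h0 => ?_⟩
    refine hne _ ((S.leaf_map_iff b P X Y₀).1 hX) ?_
    ext v
    have h := congrArg (fun ν => ν.1 (fun i => S.restrict b P (v i))) h0
    simpa [actFun, HalfDensity.map] using h
  exact key hψ

/-- The operator `b : H_P → H_{b P}` given by the action of `b ∈ Sp(Z)` on sections. -/
def act (b : S.SpZ) (P : S.Polarization) : S.H P →ₗ[ℂ] S.H (P.map b) :=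
  (S.actFun b P).restrict fun _ hψ => S.actFun_mem_H b P hψ

/-- The operator `U_P(b) = F_{P, b P} ∘ b` on `H_P` that represents `b ∈ Sp(Z)`. -/
def U (P : S.Polarization) (b : S.SpZ) : S.H P →ₗ[ℂ] S.H P :=
  S.intertwiner P (P.map b) ∘ₗ S.act b P

/-- A linear operator on `H_P` is unitary. -/
def IsUnitary (P : S.Polarization) (A : S.H P →ₗ[ℂ] S.H P) : Prop :=
  Function.Bijective A ∧ ∀ ψ φ, S.innerH P (A ψ) (A φ) = S.innerH P ψ φ

/-- An integer symplectic basis `(W₁, …, W_g; W₁⊥, …, W_g⊥)` adapted to the polarization `P`.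
The vectors `W i` have index `Sum.inl i`, and the vectors `W⊥ i` have index `Sum.inr i`. -/
structure SymplecticBasis (P : S.Polarization) where
  /-- the underlying basis of `V` -/
  basis : Module.Basis (Fin g ⊕ Fin g) ℝ V
  span_int : Submodule.span ℤ (Set.range basis) = S.Z
  span_inl : Submodule.span ℝ (Set.range fun i => basis (Sum.inl i)) = P.L
  ω_inl_inr : ∀ i j, S.ω (basis (Sum.inl i)) (basis (Sum.inr j)) = if i = j then 1 else 0
  ω_inl_inl : ∀ i j, S.ω (basis (Sum.inl i)) (basis (Sum.inl j)) = 0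
  ω_inr_inr : ∀ i j, S.ω (basis (Sum.inr i)) (basis (Sum.inr j)) = 0

namespace SymplecticBasis

variable {S} {P : S.Polarization} (w : S.SymplecticBasis P)

/-- The vector `W i`. -/
def W (i : Fin g) : V := w.basis (Sum.inl i)

/-- The vector `W⊥ i`. -/
def Wp (i : Fin g) : V := w.basis (Sum.inr i)

/-- `(W₁, …, W_g)` as a basis of the Lagrangian subspace. -/
def frame : Module.Basis (Fin g) ℝ P.L :=
  (Module.Basis.span (w.basis.linearIndependent.comp _ Sum.inl_injective)).map
    (LinearEquiv.ofEq _ _ w.span_inl)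

theorem frame_apply (i : Fin g) : (w.frame i : V) = w.W i := by
  simp [frame, W, Module.Basis.span_apply]

/-- The half-density `δ` of `P` with `δ(W₁, …, W_g) = 1`. -/
def δ : HalfDensity g P.L :=
  ⟨fun v => (Real.sqrt |w.frame.det v| : ℂ), by
    intro a v
    have h := w.frame.det_comp (a : P.L →ₗ[ℝ] P.L) v
    have h' : (⇑(a : P.L →ₗ[ℝ] P.L) ∘ v) = fun i => a (v i) := rfl
    rw [h'] at h
    change (Real.sqrt |w.frame.det fun i => a (v i)| : ℂ) = _ * (Real.sqrt |w.frame.det v| : ℂ)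
    rw [h, abs_mul, Real.sqrt_mul (abs_nonneg _), Complex.ofReal_mul]⟩

theorem δ_frame : w.δ.1 w.frame = 1 := by
  simp [δ, Module.Basis.det_self]

/-- The symplectic potential `θ_P`, evaluated at the point `X` on the vector `Y`: it vanishes on
`W i`, and its value on `W⊥ i` is `ω(X, W⊥ i)`. -/
def θ (X Y : V) : ℝ := ∑ i, S.ω (w.W i) Y * S.ω X (w.Wp i)

/-- The function `K_P` with `θ_P = θ₀ + d K_P` and `K_P(0) = 0`. -/
def K (X : V) : ℝ := 1 / 2 * ∑ i, S.ω (w.W i) X * S.ω X (w.Wp i)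

theorem θ_W (X : V) (i : Fin g) : w.θ X (w.W i) = 0 := by
  simp [θ, W, w.ω_inl_inl]

theorem θ_Wp (X : V) (i : Fin g) : w.θ X (w.Wp i) = S.ω X (w.Wp i) := by
  simp [θ, W, Wp, w.ω_inl_inr]

theorem K_zero : w.K 0 = 0 := by
  simp [K]

theorem expand (X : V) :
    X = ∑ i, S.ω X (w.Wp i) • w.W i + ∑ i, S.ω (w.W i) X • w.Wp i := by
  have h := w.basis.sum_repr X
  rw [Fintype.sum_sum_type] at h
  have h1 : ∀ i, S.ω X (w.Wp i) = w.basis.repr X (Sum.inl i) := by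
    intro i
    conv_lhs => rw [← h]
    simp [Wp, w.ω_inl_inr, w.ω_inr_inr]
  have h2 : ∀ i, S.ω (w.W i) X = w.basis.repr X (Sum.inr i) := by
    intro i
    conv_lhs => rw [← h]
    simp [W, w.ω_inl_inr, w.ω_inl_inl]
  simp only [h1, h2]
  exact h.symm

theorem ω_expand (X Y : V) :
    S.ω X Y = ∑ i, (S.ω X (w.Wp i) * S.ω (w.W i) Y - S.ω (w.W i) X * S.ω Y (w.Wp i)) := by
  have h : ∀ i, S.ω (w.Wp i) Y = - S.ω Y (w.Wp i) := fun i => (LinearMap.IsAlt.neg S.ω_alt _ _).symm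
  conv_lhs => rw [w.expand X]
  simp [h, sub_eq_add_neg, Finset.sum_add_distrib]

theorem hasDerivAt_K (X Y : V) :
    HasDerivAt (fun t : ℝ => w.K (X + t • Y)) (w.θ X Y - 1 / 2 * S.ω X Y) 0 := by
  have h : ∀ i ∈ (Finset.univ : Finset (Fin g)), HasDerivAt
      (fun t : ℝ => S.ω (w.W i) (X + t • Y) * S.ω (X + t • Y) (w.Wp i))
      (S.ω (w.W i) Y * S.ω X (w.Wp i) + S.ω (w.W i) X * S.ω Y (w.Wp i)) 0 := by
    intro i _
    have h1 : HasDerivAt (fun t : ℝ => S.ω (w.W i) (X + t • Y)) (S.ω (w.W i) Y) 0 := by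
      simpa using ((hasDerivAt_id (0 : ℝ)).mul_const (S.ω (w.W i) Y)).const_add (S.ω (w.W i) X)
    have h2 : HasDerivAt (fun t : ℝ => S.ω (X + t • Y) (w.Wp i)) (S.ω Y (w.Wp i)) 0 := by
      simpa using ((hasDerivAt_id (0 : ℝ)).mul_const (S.ω Y (w.Wp i))).const_add (S.ω X (w.Wp i))
    have h3 := h1.fun_mul h2
    simp only [zero_smul, add_zero] at h3
    exact h3
  have h' := (HasDerivAt.fun_sum h).const_mul (1 / 2 : ℝ)
  have e : w.θ X Y - 1 / 2 * S.ω X Y = 1 / 2 * ∑ i,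
      (S.ω (w.W i) Y * S.ω X (w.Wp i) + S.ω (w.W i) X * S.ω Y (w.Wp i)) := by
    rw [w.ω_expand X Y]
    simp only [θ, Finset.sum_add_distrib, Finset.sum_sub_distrib]
    have h3 : ∑ i, S.ω X (w.Wp i) * S.ω (w.W i) Y = ∑ i, S.ω (w.W i) Y * S.ω X (w.Wp i) :=
      Finset.sum_congr rfl fun i _ => mul_comm _ _
    rw [h3]
    ring
  rw [e]
  exact h'

/-- `X` lies over the Bohr–Sommerfeld leaf `Λ_q`: `k ω(W i, X) = q i` modulo `k`. -/
def IsOver (q : Fin g → ZMod S.k) (X : V) : Prop :=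
  ∀ i, ∃ n : ℤ, S.k * S.ω (w.W i) X = n ∧ (n : ZMod S.k) = q i

open Classical in
/-- The section `s_q ⊗ δ_q` over the leaf `Λ_q`, where `s_q` is given by `e^{-2π i k K_P}`. -/
def σFun (q : Fin g → ZMod S.k) (X : V) : HalfDensity g P.L :=
  if w.IsOver q X then Complex.exp (-(2 * Real.pi * Complex.I * S.k * (w.K X : ℝ))) • w.δ else 0

theorem W_mem_L (i : Fin g) : w.W i ∈ P.L := by
  rw [← w.span_inl]
  exact Submodule.subset_span ⟨i, rfl⟩

theorem W_mem_Z (i : Fin g) : w.W i ∈ S.Z := by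
  rw [← w.span_int]
  exact Submodule.subset_span ⟨_, rfl⟩

theorem Wp_mem_Z (i : Fin g) : w.Wp i ∈ S.Z := by
  rw [← w.span_int]
  exact Submodule.subset_span ⟨_, rfl⟩

theorem isOver_add_L (q : Fin g → ZMod S.k) (X : V) {Y : V} (hY : Y ∈ P.L) :
    w.IsOver q (X + Y) ↔ w.IsOver q X := by
  simp only [IsOver, map_add, P.isotropic _ (w.W_mem_L _) Y hY, add_zero]

theorem isOver_add_Z (q : Fin g → ZMod S.k) {W X : V} (hW : W ∈ S.Z) (h : w.IsOver q X) :
    w.IsOver q (X + W) := by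
  intro i
  obtain ⟨n, hn, hq⟩ := h i
  obtain ⟨m, hm⟩ := (S.Z_selfDual _).1 (w.W_mem_Z i) W hW
  refine ⟨n + S.k * m, ?_, ?_⟩
  · rw [map_add, mul_add, hn, hm]
    push_cast
    ring
  · push_cast
    simp [hq]

theorem isOver_add_Z_iff (q : Fin g → ZMod S.k) {W X : V} (hW : W ∈ S.Z) :
    w.IsOver q (X + W) ↔ w.IsOver q X := by
  refine ⟨fun h => ?_, w.isOver_add_Z q hW⟩
  have h' := w.isOver_add_Z q (S.Z.neg_mem hW) h
  rwa [add_neg_cancel_right] at h'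

/-- A point over the leaf `Λ_q`. -/
def point (q : Fin g → ZMod S.k) : V := ∑ i, (((q i).val : ℝ) / S.k) • w.Wp i

theorem ω_point (q : Fin g → ZMod S.k) (i : Fin g) :
    S.ω (w.W i) (w.point q) = ((q i).val : ℝ) / S.k := by
  simp [point, W, Wp, w.ω_inl_inr]

theorem k_ne_zero' : (S.k : ℝ) ≠ 0 := Nat.cast_ne_zero.2 S.k_pos.ne'

theorem isOver_point (q : Fin g → ZMod S.k) : w.IsOver q (w.point q) := by
  intro i
  refine ⟨(q i).val, ?_, by simp⟩
  rw [w.ω_point, mul_div_cancel₀ _ (k_ne_zero' (S := S))]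
  simp

theorem isOver_iff_leaf (q : Fin g → ZMod S.k) (X : V) :
    w.IsOver q X ↔ S.leaf P.L X = S.leaf P.L (w.point q) := by
  rw [leaf_eq_iff]
  constructor
  · intro h
    choose n hn hq using h
    have hl : ∀ i, ∃ l : ℤ, n i = (q i).val + S.k * l := by
      intro i
      have h1 : ((n i - (q i).val : ℤ) : ZMod S.k) = 0 := by
        push_cast
        simp [hq i]
      obtain ⟨l, hl⟩ := (ZMod.intCast_zmod_eq_zero_iff_dvd _ S.k).1 h1
      exact ⟨l, by omega⟩
    choose l hl using hl
    refine ⟨-∑ i, l i • w.Wp i,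
      S.Z.neg_mem (S.Z.sum_mem fun i _ => S.Z.smul_mem _ (w.Wp_mem_Z i)),
      -∑ i, S.ω X (w.Wp i) • w.W i,
      P.L.neg_mem (P.L.sum_mem fun i _ => P.L.smul_mem _ (w.W_mem_L i)), ?_⟩
    have h2 : ∀ i, S.ω (w.W i) X = ((q i).val : ℝ) / S.k + l i := by
      intro i
      have h3 := hn i
      rw [hl i] at h3
      push_cast at h3
      have hk := k_ne_zero' (S := S)
      field_simp
      linarith
    have h4 := w.expand X
    simp only [h2, add_smul, Finset.sum_add_distrib] at h4
    have h5 : ∀ i, l i • w.Wp i = (l i : ℝ) • w.Wp i := fun i => (Int.cast_smul_eq_zsmul ℝ _ _).symm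
    simp only [h5, point]
    nth_rewrite 1 [h4]
    abel
  · rintro ⟨W, hW, U, hU, h⟩
    have h1 := w.isOver_point q
    rw [← h, w.isOver_add_L q _ hU, w.isOver_add_Z_iff q hW] at h1
    exact h1

theorem exp_K_add (q : Fin g → ZMod S.k) {W X : V} (hW : W ∈ S.Z) (h : w.IsOver q X) :
    Complex.exp (-(2 * Real.pi * Complex.I * S.k * (w.K (X + W) : ℝ))) =
      Complex.exp (Real.pi * Complex.I * S.k * (S.ω W X : ℝ)) *
        Complex.exp (-(2 * Real.pi * Complex.I * S.k * (w.K X : ℝ))) := by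
  choose c hc _ using h
  have hn : ∀ i, ∃ n : ℤ, S.ω (w.W i) W = n := fun i => (S.Z_selfDual _).1 (w.W_mem_Z i) W hW
  have hm : ∀ i, ∃ n : ℤ, S.ω W (w.Wp i) = n := fun i => (S.Z_selfDual _).1 hW _ (w.Wp_mem_Z i)
  choose n hn using hn
  choose m hm using hm
  obtain ⟨r, hr⟩ := S.k_even
  have key : S.k * w.K (X + W) + S.k * S.ω W X / 2 - S.k * w.K X =
      ((∑ i, (c i * m i + r * (n i * m i)) : ℤ) : ℝ) := by
    have hk : (S.k : ℝ) = r + r := by exact_mod_cast hr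
    rw [w.ω_expand W X]
    push_cast
    simp only [K, ← hc, ← hm, ← hn, map_add, LinearMap.add_apply]
    rw [Finset.mul_sum, Finset.mul_sum, Finset.mul_sum, Finset.mul_sum, Finset.mul_sum,
      Finset.sum_div, ← Finset.sum_add_distrib, ← Finset.sum_sub_distrib]
    refine Finset.sum_congr rfl fun i _ => ?_
    rw [hk]
    ring
  rw [← Complex.exp_add, Complex.exp_eq_exp_iff_exists_int]
  refine ⟨-(∑ i, (c i * m i + r * (n i * m i)) : ℤ), ?_⟩
  have key' := congrArg (fun x : ℝ => (x : ℂ)) key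
  simp only [Complex.ofReal_add, Complex.ofReal_sub, Complex.ofReal_mul, Complex.ofReal_div,
    Complex.ofReal_natCast, Complex.ofReal_intCast, Complex.ofReal_ofNat] at key'
  rw [Int.cast_neg, ← key']
  ring

theorem σFun_mem_leafSections (q : Fin g → ZMod S.k) :
    w.σFun q ∈ S.leafSections P (S.leaf P.L (w.point q)) := by
  refine ⟨fun X hX => ?_, fun W hW X => ?_, fun X Y hY v => ?_⟩
  · have hX' : ¬ w.IsOver q X := fun h => hX ((w.isOver_iff_leaf q X).1 h)
    simp [σFun, hX']
  · by_cases h : w.IsOver q X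
    · simp only [σFun, w.isOver_add_Z_iff q hW, h, if_true, w.exp_K_add q hW h, mul_smul]
    · simp only [σFun, w.isOver_add_Z_iff q hW, h, if_false, smul_zero]
  · have hY' : ∀ t : ℝ, t • Y ∈ P.L := fun t => P.L.smul_mem t hY
    by_cases h : w.IsOver q X
    · simp only [σFun, w.isOver_add_L q X (hY' _), h, if_true]
      have h1 := w.hasDerivAt_K X Y
      have h2 : w.θ X Y = 0 := by
        simp [θ, P.isotropic _ (w.W_mem_L _) Y hY]
      rw [h2, zero_sub] at h1
      have h3 := (((h1.ofReal_comp).const_mul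
        (2 * Real.pi * Complex.I * S.k)).neg.cexp).mul_const (w.δ.1 v)
      refine HasDerivAt.congr_deriv h3 ?_
      simp only [Pi.neg_apply, zero_smul, add_zero, Submodule.coe_smul, Pi.smul_apply, smul_eq_mul]
      push_cast
      ring
    · simp only [σFun, w.isOver_add_L q X (hY' _), h, if_false]
      simpa using hasDerivAt_const (0 : ℝ) (0 : ℂ)

theorem σFun_mem_H (q : Fin g → ZMod S.k) : w.σFun q ∈ S.H P := by
  refine Submodule.mem_iSup_of_mem _ (Submodule.mem_iSup_of_mem ?_ (w.σFun_mem_leafSections q))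
  refine ⟨_, w.σFun_mem_leafSections q, fun X hX h0 => ?_⟩
  rw [← w.isOver_iff_leaf] at hX
  have h := congrArg (fun ν => ν.1 w.frame) h0
  simp [σFun, hX, w.δ_frame] at h

/-- The standard unitary basis `σ_q = s_q ⊗ δ_q` of `H_P`, for `q ∈ (ℤ / k ℤ)^g`. -/
def σ (q : Fin g → ZMod S.k) : S.H P := ⟨w.σFun q, w.σFun_mem_H q⟩

/-- The linear endomorphism of `V` with an integer matrix in the basis `(W; W⊥)`. -/
def ofMatrix (M : Matrix (Fin g ⊕ Fin g) (Fin g ⊕ Fin g) ℤ) : V →ₗ[ℝ] V :=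
  Matrix.toLin w.basis w.basis (M.map (Int.cast : ℤ → ℝ))

theorem ofMatrix_basis (M : Matrix (Fin g ⊕ Fin g) (Fin g ⊕ Fin g) ℤ) (j : Fin g ⊕ Fin g) :
    w.ofMatrix M (w.basis j) = ∑ i, M i j • w.basis i := by
  simp [ofMatrix, Matrix.toLin_self, Int.cast_smul_eq_zsmul]

theorem ofMatrix_mul (M N : Matrix (Fin g ⊕ Fin g) (Fin g ⊕ Fin g) ℤ) :
    w.ofMatrix (M * N) = w.ofMatrix M ∘ₗ w.ofMatrix N := by
  rw [ofMatrix, Matrix.map_mul_intCast, Matrix.toLin_mul w.basis w.basis w.basis]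
  rfl

theorem ofMatrix_one : w.ofMatrix 1 = LinearMap.id := by
  simp [ofMatrix, Matrix.map_one]

theorem ofMatrix_mem_Z (M : Matrix (Fin g ⊕ Fin g) (Fin g ⊕ Fin g) ℤ) {X : V} (hX : X ∈ S.Z) :
    w.ofMatrix M X ∈ S.Z := by
  rw [← w.span_int] at hX
  induction hX using Submodule.span_induction with
  | mem X h =>
    obtain ⟨j, rfl⟩ := h
    rw [w.ofMatrix_basis]
    refine S.Z.sum_mem fun i _ => S.Z.smul_mem _ ?_
    rw [← w.span_int]
    exact Submodule.subset_span ⟨i, rfl⟩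
  | zero => simp
  | add X Y _ _ hX hY =>
    rw [map_add]
    exact S.Z.add_mem hX hY
  | smul n X _ hX =>
    rw [map_zsmul]
    exact S.Z.smul_mem n hX

theorem toMatrix_ω : LinearMap.BilinForm.toMatrix w.basis S.ω = -Matrix.J (Fin g) ℝ := by
  ext i j
  rw [LinearMap.BilinForm.toMatrix_apply]
  rcases i with i | i <;> rcases j with j | j
  · simp [Matrix.J, w.ω_inl_inl]
  · simp [Matrix.J, w.ω_inl_inr, Matrix.one_apply]
  · rw [← LinearMap.IsAlt.neg S.ω_alt]
    simp [Matrix.J, w.ω_inl_inr, Matrix.one_apply, eq_comm]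
  · simp [Matrix.J, w.ω_inr_inr]

theorem ω_ofMatrix {M : Matrix (Fin g ⊕ Fin g) (Fin g ⊕ Fin g) ℤ}
    (hM : M ∈ Matrix.symplecticGroup (Fin g) ℤ) (X Y : V) :
    S.ω (w.ofMatrix M X) (w.ofMatrix M Y) = S.ω X Y := by
  have h : S.ω.comp (w.ofMatrix M) (w.ofMatrix M) = S.ω := by
    apply (LinearMap.BilinForm.toMatrix w.basis).injective
    rw [LinearMap.BilinForm.toMatrix_comp w.basis w.basis, ofMatrix, LinearMap.toMatrix_toLin,
      w.toMatrix_ω]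
    have h1 := SymplecticGroup.mem_iff'.1 (SymplecticGroup.map_mem hM (Int.castRingHom ℝ))
    have h2 : M.map (Int.castRingHom ℝ) = M.map (Int.cast : ℤ → ℝ) := rfl
    rw [h2] at h1
    rw [Matrix.mul_neg, Matrix.neg_mul, h1]
  exact congrArg (fun B => B X Y) h

/-- The identification of `Sp(2g, ℤ)` with `Sp(Z)` by means of the basis `(W; W⊥)`. -/
def ofSymplectic (M : Matrix.symplecticGroup (Fin g) ℤ) : S.SpZ :=
  ⟨LinearEquiv.ofLinearMap (w.ofMatrix M.1) (w.ofMatrix (M⁻¹).1)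
    (by
      rw [← ofMatrix_mul, ← ofMatrix_one, ← Submonoid.coe_mul, mul_inv_cancel]
      rfl)
    (by
      rw [← ofMatrix_mul, ← ofMatrix_one, ← Submonoid.coe_mul, inv_mul_cancel]
      rfl), by
    refine ⟨fun X Y => w.ω_ofMatrix M.2 X Y, fun X => ⟨fun h => ?_, w.ofMatrix_mem_Z M.1⟩⟩
    have h1 := w.ofMatrix_mem_Z (M⁻¹).1 h
    have h2 : w.ofMatrix (M⁻¹).1 (w.ofMatrix M.1 X) = X := by
      rw [← LinearMap.comp_apply, ← ofMatrix_mul, ← Submonoid.coe_mul, inv_mul_cancel]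
      exact congrArg (fun f => f X) w.ofMatrix_one
    rw [← h2]
    exact h1⟩

/-- The element `α = [[A, 0], [0, ᵗA⁻¹]]` of `Sp(Z)`, for `A ∈ GL(g, ℤ)`. -/
def α (A : GL (Fin g) ℤ) : S.SpZ :=
  w.ofSymplectic ⟨Matrix.fromBlocks A.1 0 0 (A⁻¹).1ᵀ, by
    have h : A.1 * (A⁻¹).1 = 1 := A.mul_inv
    have h' : (A⁻¹).1ᵀ * A.1ᵀ = 1 := by rw [← Matrix.transpose_mul, h, Matrix.transpose_one]
    rw [SymplecticGroup.mem_iff, Matrix.J, Matrix.fromBlocks_transpose,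
      Matrix.fromBlocks_multiply, Matrix.fromBlocks_multiply]
    simp only [Matrix.zero_mul, Matrix.mul_zero, Matrix.mul_neg, Matrix.neg_mul, Matrix.mul_one,
      Matrix.transpose_zero, Matrix.transpose_transpose, add_zero, zero_add, neg_zero, h, h']⟩

/-- The element `β = [[I, B], [0, I]]` of `Sp(Z)`, for a symmetric integer matrix `B`. -/
def β (B : Matrix (Fin g) (Fin g) ℤ) (hB : Bᵀ = B) : S.SpZ :=
  w.ofSymplectic ⟨Matrix.fromBlocks 1 B 0 1, by
    rw [SymplecticGroup.mem_iff, Matrix.J, Matrix.fromBlocks_transpose,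
      Matrix.fromBlocks_multiply, Matrix.fromBlocks_multiply]
    simp [hB]⟩

/-- The element `γ = [[0, I], [-I, 0]]` of `Sp(Z)`. -/
def γ : S.SpZ :=
  w.ofSymplectic ⟨Matrix.fromBlocks 0 1 (-1) 0, by
    rw [SymplecticGroup.mem_iff, Matrix.J, Matrix.fromBlocks_transpose,
      Matrix.fromBlocks_multiply, Matrix.fromBlocks_multiply]
    simp⟩

end SymplecticBasis

end SymplecticTorus

end TorusQuantization

end

open scoped Matrix

noncomputable section

namespace TorusQuantization

/-! Write X in the coordinates x_i = ω(W_i, X) and y_i = ω(X, W_i^⊥). A covariantly constant section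
is determined by its value at one point, because parallel transport along P (`leafSections_add`) and
the lattice action reach the whole leaf. Comparing these two along W_i forces k x_i to be an integer
over a Bohr–Sommerfeld leaf (`exists_isOver`). Hence the leaves are the Λ_q, each contributes a line
spanned by σ_q, and orthonormality is immediate: the supports are disjoint, the phases have modulus
1, and δ is 1 on every lattice frame (`abs_det_of_isLatticeFrame`).

An element b of Sp(Z) carries σ_q to the standard basis vector of b P built from the transported
symplectic basis (`act_σ`). So U_P(b) is read off from the pairing of two standard bases
(`intertwiner_spec`), and only the potentials, the leaf labels and the half-densities need
comparison.

If b preserves P (`U_of_map_L_eq`), the leaves coincide up to relabelling and the coefficient is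
e^{2πik(K - K_b)}, with K_b the potential of the transported basis. For α the sum Σ x_i y_i is
invariant, so only the label moves. For β the labels stay and K changes by half the quadratic form
of B in x = n/k, which gives the Gauss phase; symmetry of B and evenness of k make it depend on n
modulo k only.

For γ the polarizations are transverse. Two leaves meet in one point of the torus, the potentials
are opposite, and the phase is e^{4πikK}, a character of q and q_1. The half-densities contribute
k^{-g/2} (`δ_mul_δ_γ`). Unitarity is orthogonality of characters of ℤ/k (`sum_prod_stdAddChar`). -/

/-- A half-density is determined by its value on a basis. -/
theorem HalfDensity.apply_eq {g : ℕ} {V : Type*} [AddCommGroup V] [Module ℝ V]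
    {L : Submodule ℝ V} (e : Module.Basis (Fin g) ℝ L) (ν : HalfDensity g L) (v : Fin g → L) :
    ν.1 v = (Real.sqrt |e.det v| : ℂ) * ν.1 e := by
  have : FiniteDimensional ℝ L := e.finiteDimensional_of_finite
  by_cases hv : LinearIndependent ℝ v ∧ Submodule.span ℝ (Set.range v) = ⊤
  -- When v is a basis, the automorphism carrying e to v has determinant `e.det v`, so the
  -- transformation law gives the formula directly.
  · set b := Module.Basis.mk hv.1 hv.2.ge with hb
    have hbv : ∀ i, b i = v i := fun i => by simp [hb]
    have h := ν.2 (e.equiv b (Equiv.refl _)) e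
    simp only [Module.Basis.equiv_apply, Equiv.refl_apply, hbv] at h
    have hdet := Module.Basis.det_basis b e
    rw [show (b : Fin g → L) = v from funext hbv] at hdet
    rw [← hdet]
    exact h
  · have hdet : e.det v = 0 := by
      by_contra hne
      exact hv ((Module.Basis.is_basis_iff_det e).2 (isUnit_iff_ne_zero.2 hne))
    have hspan : Submodule.span ℝ (Set.range v) < ⊤ := by
      rw [lt_top_iff_ne_top]
      intro h
      refine hv ⟨linearIndependent_of_top_le_span_of_card_eq_finrank h.ge ?_, h⟩
      rw [Module.finrank_eq_card_basis e]
    obtain ⟨f, hf, hker⟩ := Submodule.exists_le_ker_of_lt_top _ hspan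
    -- The transvection x ↦ x + f(x) u fixes every v i and has determinant 1 + f(u) = 4. The
    -- transformation law then reads ν(v) = 2 ν(v), so ν(v) = 0.
    obtain ⟨u, hu⟩ : ∃ u, f u = 3 := LinearMap.surjective hf 3
    have hd : LinearMap.det (LinearMap.transvection f u) = 4 := by
      rw [LinearMap.transvection.det, hu]
      norm_num
    have h := ν.2 (LinearMap.equivOfDetNeZero (LinearMap.transvection f u) (by simp [hd])) v
    have hc : ((LinearMap.equivOfDetNeZero (LinearMap.transvection f u) (by simp [hd]) : L ≃ₗ[ℝ] L)
      : L →ₗ[ℝ] L) = LinearMap.transvection f u := by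
      ext; rfl
    have hfix : (fun i => LinearMap.equivOfDetNeZero (LinearMap.transvection f u) (by simp [hd])
      (v i)) = v := by
      funext i
      have : f (v i) = 0 := hker (Submodule.subset_span ⟨i, rfl⟩)
      change LinearMap.transvection f u (v i) = v i
      simp [LinearMap.transvection.apply, this]
    rw [hfix, hc, hd] at h
    have h4 : Real.sqrt |(4 : ℝ)| = 2 := by
      rw [abs_of_pos (by norm_num), show (4 : ℝ) = 2 ^ 2 by norm_num, Real.sqrt_sq (by norm_num)]
    rw [h4] at h
    rw [hdet]
    simp only [abs_zero, Real.sqrt_zero, Complex.ofReal_zero, zero_mul]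
    push_cast at h
    linear_combination -h

/-! ### Covariantly constant sections and integrals over translates. -/

namespace SymplecticTorus

variable {g : ℕ} {V : Type*} [AddCommGroup V] [Module ℝ V] (S : SymplecticTorus g V)

/-- Parallel transport of covariantly constant sections along the polarization. -/
theorem leafSections_add {P : S.Polarization} {Λ : S.Leaf P.L} {ψ : V → HalfDensity g P.L}
    (hψ : ψ ∈ S.leafSections P Λ) (X : V) {Y : V} (hY : Y ∈ P.L) :
    ψ (X + Y) = Complex.exp (Real.pi * Complex.I * S.k * (S.ω X Y : ℝ)) • ψ X := by
  ext v
  set c : ℂ := 2 * Real.pi * Complex.I * S.k * ((1 / 2 * S.ω X Y : ℝ) : ℂ) with hc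
  -- The connection condition only concerns t = 0. Applied at the base point X + tY it gives all t,
  -- with the same coefficient c because ω(Y, Y) = 0.
  have hf : ∀ t : ℝ, HasDerivAt (fun t : ℝ => (ψ (X + t • Y)).1 v) (c * (ψ (X + t • Y)).1 v) t := by
    intro t
    have h := hψ.2.2 (X + t • Y) Y hY v
    have hω : S.ω (X + t • Y) Y = S.ω X Y := by simp [S.ω_alt Y]
    rw [hω, ← hc, ← sub_self t] at h
    have h' := h.comp_sub_const t t
    refine h'.congr_of_eventuallyEq (Filter.Eventually.of_forall fun s => ?_)
    simp only [add_assoc, ← add_smul, add_sub_cancel]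
  -- Integrating factor: e^{-ct} times the section has zero derivative, so its values at t = 0 and t
  -- = 1 agree.
  have hg : ∀ t : ℝ, HasDerivAt (fun t : ℝ => Complex.exp (-(c * t)) * (ψ (X + t • Y)).1 v) 0 t := by
    intro t
    have he : HasDerivAt (fun t : ℝ => Complex.exp (-(c * t))) (Complex.exp (-(c * t)) * (-c)) t := by
      have h1 := ((Complex.ofRealCLM.hasDerivAt (x := t)).const_mul c).fun_neg.cexp
      simpa using h1
    have h2 := he.fun_mul (hf t)
    refine h2.congr_deriv ?_
    ring
  have hconst := is_const_of_deriv_eq_zero (fun t => (hg t).differentiableAt)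
    (fun t => (hg t).deriv) 1 0
  simp only [Complex.ofReal_one, Complex.ofReal_zero, mul_one, mul_zero, neg_zero, Complex.exp_zero,
    one_mul, one_smul, zero_smul, add_zero] at hconst
  have hcc : Complex.exp c * Complex.exp (-c) = 1 := by rw [← Complex.exp_add]; simp
  have hce : (Real.pi * Complex.I * S.k * (S.ω X Y : ℝ) : ℂ) = c := by
    rw [hc]; push_cast; ring
  rw [hce]
  simp only [Submodule.coe_smul, Pi.smul_apply, smul_eq_mul]
  rw [← hconst, ← mul_assoc, hcc, one_mul]

/-- A covariantly constant section over a leaf is determined by its value at a point. -/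
theorem leafSections_eq_zero {P : S.Polarization} {X : V} {ψ : V → HalfDensity g P.L}
    (hψ : ψ ∈ S.leafSections P (S.leaf P.L X)) (h0 : ψ X = 0) : ψ = 0 := by
  funext Y
  by_cases hY : S.leaf P.L Y = S.leaf P.L X
  · obtain ⟨W, hW, U, hU, rfl⟩ := (S.leaf_eq_iff _ _ _).1 hY.symm
    rw [S.leafSections_add hψ _ hU, hψ.2.1 W hW, h0]
    simp
  · exact hψ.1 Y hY

theorem leaf_add {D : Submodule ℝ V} (X : V) {Y : V} (hY : Y ∈ D) :
    S.leaf D (X + Y) = S.leaf D X :=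
  ((S.leaf_eq_iff D X (X + Y)).2 ⟨0, S.Z.zero_mem, Y, hY, by simp⟩).symm

open Classical in
/-- The integral of a density that is a linear combination of densities, each of them constant on
one translate and zero on all others. -/
theorem integral_eq_sum {ι : Type} [Fintype ι] {J : Type*} [Fintype J] {D : Submodule ℝ V}
    {w : ι → V} (hw : ∀ i, w i ∈ D) {f : V → ℂ} (c : J → ℂ) (Λ : J → S.Leaf D)
    (hf : ∀ X, f X = ∑ j, if S.leaf D X = Λ j then c j else 0) :
    S.integral D w f = ∑ j, c j := by
  have h1 : ∀ Λ' : S.Leaf D, ∫ t in Set.Icc (0 : ι → ℝ) 1,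
      f (Quotient.out Λ' + ∑ i, t i • w i) = ∑ j, if Λ' = Λ j then c j else 0 := by
    intro Λ'
    have h2 : ∀ t : ι → ℝ, f (Quotient.out Λ' + ∑ i, t i • w i) =
        ∑ j, if Λ' = Λ j then c j else 0 := by
      intro t
      have h3 : S.leaf D (Quotient.out Λ') = Λ' := Quotient.out_eq' Λ'
      rw [hf, S.leaf_add _ (D.sum_mem fun i _ => D.smul_mem _ (hw i)), h3]
    -- The integrand is constant along the translate and the unit cube has volume 1. This includes
    -- the empty index type, where the cube is a point.
    simp only [h2, MeasureTheory.integral_const]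
    simp [MeasureTheory.measureReal_def, Real.volume_Icc_pi]
  unfold integral
  simp only [h1]
  rw [finsum_sum_comm]
  · refine Finset.sum_congr rfl fun j _ => ?_
    rw [finsum_eq_single _ (Λ j) fun Λ' h => if_neg h, if_pos rfl]
  · intro j _
    refine (Set.finite_singleton (Λ j)).subset fun Λ' h => ?_
    by_contra h'
    exact h (if_neg h')

theorem IsLatticeFrame.mem_Z {P : S.Polarization} {v : Fin g → P.L} (hv : S.IsLatticeFrame P v)
    (i : Fin g) : (v i : V) ∈ S.Z := by
  have h : (v i : V) ∈ S.Z ⊓ P.L.restrictScalars ℤ := by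
    rw [← hv.span_eq]
    exact Submodule.subset_span ⟨i, rfl⟩
  exact h.1

/-! ### Bohr–Sommerfeld leaves and the standard unitary basis. -/

namespace SymplecticBasis

variable {S} {P : S.Polarization} (w : S.SymplecticBasis P)

theorem IsOver.unique {w : S.SymplecticBasis P} {q q' : Fin g → ZMod S.k} {X : V}
    (h : w.IsOver q X) (h' : w.IsOver q' X) : q = q' := by
  funext i
  obtain ⟨n, hn, hq⟩ := h i
  obtain ⟨n', hn', hq'⟩ := h' i
  rw [← hq, ← hq', Int.cast_injective (α := ℝ) (hn.symm.trans hn')]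

/-- The coordinates of a lattice point of P are its pairings with the lattice vectors W_i^⊥, hence
integers. -/
theorem isLatticeFrame : S.IsLatticeFrame P w.frame where
  linearIndependent := w.frame.linearIndependent
  span_eq := by
    simp only [w.frame_apply]
    apply le_antisymm
    · rw [Submodule.span_le]
      rintro _ ⟨i, rfl⟩
      exact ⟨w.W_mem_Z i, w.W_mem_L i⟩
    · rintro X ⟨hZ, hL⟩
      rw [w.expand X]
      refine Submodule.add_mem _ (Submodule.sum_mem _ fun i _ => ?_)
        (Submodule.sum_mem _ fun i _ => ?_)
      · obtain ⟨n, hn⟩ := (S.Z_selfDual _).1 hZ _ (w.Wp_mem_Z i)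
        rw [hn, Int.cast_smul_eq_zsmul]
        exact Submodule.smul_mem _ _ (Submodule.subset_span ⟨i, rfl⟩)
      · rw [P.isotropic _ (w.W_mem_L i) X hL, zero_smul]
        exact Submodule.zero_mem _

theorem frame_repr (X : P.L) (i : Fin g) : w.frame.repr X i = S.ω (X : V) (w.Wp i) := by
  have h := congrArg (Subtype.val) (w.frame.sum_repr X)
  simp only [Submodule.coe_sum, Submodule.coe_smul, w.frame_apply] at h
  conv_rhs => rw [← h]
  simp [W, Wp, w.ω_inl_inr]

/-- The determinant of a lattice frame is `±1`. -/
theorem abs_det_of_isLatticeFrame {v : Fin g → P.L} (hv : S.IsLatticeFrame P v) :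
    |w.frame.det v| = 1 := by
  have hM : ∀ i j, ∃ n : ℤ, w.frame.repr (v j) i = n := fun i j => by
    rw [w.frame_repr]
    exact (S.Z_selfDual _).1 (hv.mem_Z S j) _ (w.Wp_mem_Z i)
  choose M hM using hM
  -- M expresses v in the W_i and N expresses the W_i in v, both over ℤ. Their determinants are
  -- integers with product 1.
  have hN : ∀ j, ∃ c : Fin g → ℤ, ∑ i, c i • (v i : V) = w.W j := fun j => by
    rw [← Submodule.mem_span_range_iff_exists_fun ℤ, hv.span_eq]
    exact ⟨w.W_mem_Z j, w.W_mem_L j⟩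
  choose N hN using hN
  have h1 : w.frame.toMatrix v = (Matrix.of M).map (Int.cast : ℤ → ℝ) := by
    ext i j
    simp [Module.Basis.toMatrix_apply, hM]
  have h2 : w.frame.toMatrix v * ((Matrix.of N).map (Int.cast : ℤ → ℝ))ᵀ = 1 := by
    ext i j
    have h3 : w.frame j = ∑ l, (N j l : ℝ) • v l := by
      ext
      rw [w.frame_apply, ← hN]
      simp [Int.cast_smul_eq_zsmul]
    have h4 : w.frame.repr (w.frame j) i = (1 : Matrix (Fin g) (Fin g) ℝ) i j := by
      simp [Matrix.one_apply, Finsupp.single_apply, eq_comm]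
    rw [← h4]
    conv_rhs => rw [h3]
    simp [Matrix.mul_apply, Module.Basis.toMatrix_apply, mul_comm]
  have h5 := congrArg Matrix.det h2
  rw [h1, Matrix.det_mul, Matrix.det_transpose, Matrix.det_one, ← Int.cast_det, ← Int.cast_det]
    at h5
  have h6 : (Matrix.of M).det * (Matrix.of N).det = 1 := by exact_mod_cast h5
  rw [Module.Basis.det_apply, h1, ← Int.cast_det]
  rcases Int.isUnit_iff.1 (IsUnit.of_mul_eq_one _ h6) with h | h <;> simp [h]

theorem δ_of_isLatticeFrame {v : Fin g → P.L} (hv : S.IsLatticeFrame P v) : w.δ.1 v = 1 := by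
  simp [δ, w.abs_det_of_isLatticeFrame hv]

theorem isLatticeFrame_latticeFrame (w : S.SymplecticBasis P) :
    S.IsLatticeFrame P (S.latticeFrame P) :=
  Classical.epsilon_spec ⟨_, w.isLatticeFrame⟩

open Classical in
theorem σ_apply (q : Fin g → ZMod S.k) (X : V) (v : Fin g → P.L) :
    ((w.σ q).1 X).1 v = if w.IsOver q X then
      Complex.exp (-(2 * Real.pi * Complex.I * S.k * (w.K X : ℝ))) * w.δ.1 v else 0 := by
  simp only [σ, σFun]
  split_ifs <;> simp

/-- A Bohr–Sommerfeld leaf is one of the leaves `Λ_q`. -/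
theorem exists_isOver {X : V} (h : S.leaf P.L X ∈ S.bohrSommerfeld P) :
    ∃ q, w.IsOver q X := by
  obtain ⟨ψ, hψ, hne⟩ := h
  have hi : ∀ i, ∃ n : ℤ, S.k * S.ω (w.W i) X = n := by
    intro i
    -- Translation by W_i is both parallel transport and a lattice translation. Where the section
    -- does not vanish, the two phases agree, so e^{2πikω(W_i, X)} = 1.
    have h1 := S.leafSections_add hψ X (w.W_mem_L i)
    have h2 := hψ.2.1 _ (w.W_mem_Z i) X
    rw [h1] at h2
    have h3 := smul_left_injective ℂ (hne X rfl) h2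
    obtain ⟨n, hn⟩ := Complex.exp_eq_exp_iff_exists_int.1 h3
    rw [← LinearMap.IsAlt.neg S.ω_alt] at hn
    have hpi : (Real.pi * Complex.I : ℂ) ≠ 0 :=
      mul_ne_zero (Complex.ofReal_ne_zero.2 Real.pi_ne_zero) Complex.I_ne_zero
    have h4 : (Real.pi * Complex.I : ℂ) * (2 * (S.k * (S.ω (w.W i) X : ℝ) + n)) = 0 := by
      push_cast at hn
      linear_combination -hn
    have h5 : (S.k * (S.ω (w.W i) X : ℝ) + n : ℂ) = 0 := by
      simpa using (mul_eq_zero.1 h4).resolve_left hpi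
    refine ⟨-n, ?_⟩
    have h6 : ((S.k * (S.ω (w.W i) X : ℝ) + n : ℝ) : ℂ) = 0 := by push_cast; exact h5
    rw [Complex.ofReal_eq_zero] at h6
    push_cast
    linarith
  choose n hn using hi
  exact ⟨fun i => (n i : ZMod S.k), fun i => ⟨n i, hn i, rfl⟩⟩

/-- Each S_Λ is a line: subtracting the multiple of σ_q that matches ψ at `w.point q` leaves a
section vanishing at a point of its leaf, hence everywhere. -/
theorem span_σ : Submodule.span ℂ (Set.range w.σ) = ⊤ := by
  have key : S.H P ≤ Submodule.span ℂ (Set.range w.σFun) := by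
    refine iSup₂_le fun Λ hΛ ψ hψ => ?_
    obtain ⟨X, rfl⟩ := QuotientAddGroup.mk_surjective Λ
    obtain ⟨q, hq⟩ := w.exists_isOver hΛ
    change ψ ∈ S.leafSections P (S.leaf P.L X) at hψ
    rw [(w.isOver_iff_leaf q X).1 hq] at hψ
    have h0 : w.σFun q (w.point q) =
        Complex.exp (-(2 * Real.pi * Complex.I * S.k * (w.K (w.point q) : ℝ))) • w.δ := by
      simp [σFun, w.isOver_point]
    set e := Complex.exp (-(2 * Real.pi * Complex.I * S.k * (w.K (w.point q) : ℝ))) with he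
    set c := (ψ (w.point q)).1 w.frame / e with hc
    have h1 : ψ - c • w.σFun q = 0 := by
      refine S.leafSections_eq_zero
        (Submodule.sub_mem _ hψ (Submodule.smul_mem _ c (w.σFun_mem_leafSections q))) ?_
      ext v
      have h2 : e ≠ 0 := Complex.exp_ne_zero _
      simp only [Pi.sub_apply, Pi.smul_apply, h0, Submodule.coe_sub, Submodule.coe_smul,
        smul_eq_mul]
      rw [HalfDensity.apply_eq w.frame (ψ (w.point q)) v, HalfDensity.apply_eq w.frame w.δ v,
        w.δ_frame, hc]
      field_simp
      simp
    rw [sub_eq_zero.1 h1]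
    exact Submodule.smul_mem _ _ (Submodule.subset_span ⟨q, rfl⟩)
  rw [eq_top_iff]
  rintro ⟨ψ, hψ⟩ -
  have h := key hψ
  have h1 : Set.range w.σFun = (S.H P).subtype '' Set.range w.σ := by
    rw [← Set.range_comp]
    rfl
  rw [h1, ← Submodule.map_span] at h
  obtain ⟨φ, hφ, rfl⟩ := h
  exact hφ

theorem exists_sum (ψ : S.H P) : ∃ a : (Fin g → ZMod S.k) → ℂ, ∑ q, a q • w.σ q = ψ := by
  rw [← Submodule.mem_span_range_iff_exists_fun ℂ, w.span_σ]
  trivial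

theorem sum_apply (a : (Fin g → ZMod S.k) → ℂ) (X : V) (v : Fin g → P.L) :
    ((∑ q, a q • w.σ q : S.H P).1 X).1 v = ∑ q, a q * ((w.σ q).1 X).1 v := by
  simp [Finset.sum_apply]

theorem conj_exp (X : V) :
    (starRingEnd ℂ) (Complex.exp (-(2 * Real.pi * Complex.I * S.k * (w.K X : ℝ)))) =
      Complex.exp (2 * Real.pi * Complex.I * S.k * (w.K X : ℝ)) := by
  rw [← Complex.exp_conj]
  simp only [map_neg, map_mul, Complex.conj_I, Complex.conj_ofReal, map_natCast, map_ofNat]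
  congr 1
  ring

-- Distinct σ_q have disjoint supports, so only diagonal terms survive. There the phases cancel, and
-- δ is 1 on the chosen lattice frame, whichever one it is.
open Classical in
theorem innerH_sum (a b : (Fin g → ZMod S.k) → ℂ) :
    S.innerH P (∑ q, a q • w.σ q) (∑ q, b q • w.σ q) = ∑ q, (starRingEnd ℂ) (a q) * b q := by
  unfold innerH
  refine S.integral_eq_sum (fun i => (S.latticeFrame P i).2) _
    (fun q => S.leaf P.L (w.point q)) fun X => ?_
  simp only [w.sum_apply, map_sum, ← w.isOver_iff_leaf]
  rw [Finset.sum_mul_sum]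
  refine Finset.sum_congr rfl fun q _ => ?_
  rw [Finset.sum_eq_single q]
  · simp only [w.σ_apply, w.δ_of_isLatticeFrame w.isLatticeFrame_latticeFrame]
    split_ifs with h
    · have h1 : (starRingEnd ℂ) (Complex.exp (-(2 * Real.pi * Complex.I * S.k * (w.K X : ℝ)))) *
          Complex.exp (-(2 * Real.pi * Complex.I * S.k * (w.K X : ℝ))) = 1 := by
        rw [w.conj_exp, ← Complex.exp_add]
        simp
      simp only [map_mul, mul_one]
      linear_combination (starRingEnd ℂ) (a q) * b q * h1
    · simp
  · intro q' _ hq'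
    simp only [w.σ_apply]
    split_ifs with h h'
    · exact absurd (h'.unique h) hq'
    all_goals simp
  · simp

theorem σ_eq_sum (q : Fin g → ZMod S.k) :
    w.σ q = ∑ q', (Pi.single q 1 : (Fin g → ZMod S.k) → ℂ) q' • w.σ q' := by
  simp [Pi.single_apply]

theorem innerH_σ_sum (q : Fin g → ZMod S.k) (b : (Fin g → ZMod S.k) → ℂ) :
    S.innerH P (w.σ q) (∑ q, b q • w.σ q) = b q := by
  rw [w.σ_eq_sum q, innerH_sum]
  simp [Pi.single_apply]

theorem innerH_σ (q q' : Fin g → ZMod S.k) :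
    S.innerH P (w.σ q) (w.σ q') = if q = q' then 1 else 0 := by
  rw [w.σ_eq_sum q', innerH_σ_sum]
  simp [Pi.single_apply]

theorem linearIndependent_σ : LinearIndependent ℂ w.σ := by
  rw [Fintype.linearIndependent_iffₛ]
  intro a b hab q
  rw [← w.innerH_σ_sum q a, hab, w.innerH_σ_sum]

end SymplecticBasis

/-! ### Adapted frames, transport by Sp(Z), and operators induced by the pairing. -/

theorem IsAdaptedFrame.mem_inf {S : SymplecticTorus g V} {P₂ P₁ : S.Polarization}
    {U₂ : Fin g → P₂.L} {U₁ : Fin g → P₁.L} {T : Fin g → V}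
    (h : S.IsAdaptedFrame P₂ P₁ U₂ U₁ T) {j : Fin g} (hj : S.codim P₂ P₁ ≤ j) :
    (U₂ j : V) ∈ P₂.L ⊓ P₁.L := by
  refine ⟨(U₂ j).2, ?_⟩
  rw [h.common j hj]
  exact (U₁ j).2

theorem codim_of_L_eq {P₂ P₁ : S.Polarization} (h : P₁.L = P₂.L) : S.codim P₂ P₁ = 0 := by
  rw [codim, h, inf_idem, P₂.finrank_eq, Nat.sub_self]

/-- For two polarizations with the same Lagrangian subspace, the two frames of an adapted frame are
lattice frames. -/
theorem IsAdaptedFrame.isLatticeFrame {S : SymplecticTorus g V} {P₂ P₁ : S.Polarization}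
    {U₂ : Fin g → P₂.L} {U₁ : Fin g → P₁.L} {T : Fin g → V}
    (h : S.IsAdaptedFrame P₂ P₁ U₂ U₁ T) (hL : P₁.L = P₂.L) :
    S.IsLatticeFrame P₂ U₂ ∧ S.IsLatticeFrame P₁ U₁ := by
  have h0 : ∀ j : Fin g, S.codim P₂ P₁ ≤ j := fun j => by simp [S.codim_of_L_eq hL]
  have h1 := h.span_eq
  have h2 : {j : Fin g | S.codim P₂ P₁ ≤ j} = Set.univ := Set.eq_univ_of_forall h0
  rw [h2, Set.image_univ] at h1
  refine ⟨⟨h.linearIndependent₂, ?_⟩, ⟨h.linearIndependent₁, ?_⟩⟩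
  · rw [h1, hL, inf_idem]
  · simp only [← fun j => h.common j (h0 j)]
    rw [h1, hL, inf_idem]

namespace SymplecticBasis

variable {S} {P : S.Polarization} (w : S.SymplecticBasis P)

/-- The image under `b ∈ Sp(Z)` of a symplectic basis adapted to `P` is adapted to `b P`. -/
def map (b : S.SpZ) : S.SymplecticBasis (P.map b) where
  basis := w.basis.map (b : V ≃ₗ[ℝ] V)
  span_int := by
    have h : Set.range (w.basis.map (b : V ≃ₗ[ℝ] V)) =
        ((b : V ≃ₗ[ℝ] V).toLinearMap.restrictScalars ℤ) '' Set.range w.basis := by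
      rw [← Set.range_comp]
      ext X
      simp
    rw [h, ← Submodule.map_span, w.span_int]
    ext X
    constructor
    · rintro ⟨Y, hY, rfl⟩
      exact (b.2.2 Y).2 hY
    · intro hX
      refine ⟨(b : V ≃ₗ[ℝ] V).symm X, (b.2.2 _).1 ?_, by simp⟩
      rwa [LinearEquiv.apply_symm_apply]
  span_inl := by
    have h : (Set.range fun i => w.basis.map (b : V ≃ₗ[ℝ] V) (Sum.inl i)) =
        (b : V ≃ₗ[ℝ] V).toLinearMap '' Set.range fun i => w.basis (Sum.inl i) := by
      rw [← Set.range_comp]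
      ext X
      simp
    rw [h, ← Submodule.map_span, w.span_inl]
    rfl
  ω_inl_inr i j := by
    simp only [Module.Basis.map_apply, b.2.1, w.ω_inl_inr]
  ω_inl_inl i j := by
    simp only [Module.Basis.map_apply, b.2.1, w.ω_inl_inl]
  ω_inr_inr i j := by
    simp only [Module.Basis.map_apply, b.2.1, w.ω_inr_inr]

theorem map_W (b : S.SpZ) (i : Fin g) : (w.map b).W i = (b : V ≃ₗ[ℝ] V) (w.W i) := by
  simp [W, map]

theorem map_Wp (b : S.SpZ) (i : Fin g) : (w.map b).Wp i = (b : V ≃ₗ[ℝ] V) (w.Wp i) := by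
  simp [Wp, map]

theorem ω_map_W (b : S.SpZ) (i : Fin g) (X : V) :
    S.ω ((w.map b).W i) X = S.ω (w.W i) ((b : V ≃ₗ[ℝ] V).symm X) := by
  rw [map_W, ← b.2.1 (w.W i), LinearEquiv.apply_symm_apply]

theorem ω_map_Wp (b : S.SpZ) (i : Fin g) (X : V) :
    S.ω X ((w.map b).Wp i) = S.ω ((b : V ≃ₗ[ℝ] V).symm X) (w.Wp i) := by
  rw [map_Wp, ← b.2.1 _ (w.Wp i), LinearEquiv.apply_symm_apply]

theorem map_K (b : S.SpZ) (X : V) : (w.map b).K X = w.K ((b : V ≃ₗ[ℝ] V).symm X) := by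
  simp only [K, ω_map_W, ω_map_Wp]

theorem map_isOver (b : S.SpZ) (q : Fin g → ZMod S.k) (X : V) :
    (w.map b).IsOver q X ↔ w.IsOver q ((b : V ≃ₗ[ℝ] V).symm X) := by
  simp only [IsOver, ω_map_W]

theorem map_frame (b : S.SpZ) (i : Fin g) :
    (w.map b).frame i = S.restrict b P (w.frame i) := by
  ext
  rw [frame_apply, map_W, ← w.frame_apply]
  rfl

/-- The operator `b` carries the standard basis of `H_P` to the standard basis of `H_{b P}`. -/
theorem act_σ (b : S.SpZ) (q : Fin g → ZMod S.k) : S.act b P (w.σ q) = (w.map b).σ q := by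
  -- Both half-densities take the value 1 on the transported frame, and one value on a basis
  -- determines a half-density.
  have hδ : HalfDensity.map (S.restrict b P) w.δ = (w.map b).δ := by
    ext v
    rw [HalfDensity.apply_eq (w.map b).frame _ v, HalfDensity.apply_eq (w.map b).frame _ v]
    congr 1
    rw [δ_frame]
    change w.δ.1 (fun i => (S.restrict b P).symm ((w.map b).frame i)) = 1
    simp only [map_frame, LinearEquiv.symm_apply_apply]
    exact w.δ_frame
  apply Subtype.ext
  funext X
  change HalfDensity.map (S.restrict b P) (w.σFun q ((b : V ≃ₗ[ℝ] V).symm X)) = (w.map b).σFun q X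
  by_cases h : w.IsOver q ((b : V ≃ₗ[ℝ] V).symm X)
  · rw [σFun, σFun, if_pos h, if_pos ((w.map_isOver b q X).2 h), map_K, map_smul, hδ]
  · rw [σFun, σFun, if_neg h, if_neg (mt (w.map_isOver b q X).1 h), map_zero]

/-- The standard basis of `H_P`. -/
def σBasis : Module.Basis (Fin g → ZMod S.k) ℂ (S.H P) :=
  Module.Basis.mk w.linearIndependent_σ w.span_σ.ge

theorem σBasis_apply (q : Fin g → ZMod S.k) : w.σBasis q = w.σ q := by
  simp [σBasis]

theorem eq_of_innerH {ψ φ : S.H P} (h : ∀ q, S.innerH P (w.σ q) ψ = S.innerH P (w.σ q) φ) :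
    ψ = φ := by
  obtain ⟨a, rfl⟩ := w.exists_sum ψ
  obtain ⟨b, rfl⟩ := w.exists_sum φ
  simp only [innerH_σ_sum] at h
  simp only [h]

open Classical in
/-- The operator induced by the pairing, if the pairing of two standard basis vectors is the
integral of a density that is constant on one translate and zero on all others. -/
theorem intertwiner_spec {P₂ P₁ : S.Polarization} (w₂ : S.SymplecticBasis P₂)
    (w₁ : S.SymplecticBasis P₁) (M : (Fin g → ZMod S.k) → (Fin g → ZMod S.k) → ℂ)
    (Λ : (Fin g → ZMod S.k) → (Fin g → ZMod S.k) → S.Leaf (P₂.L ⊓ P₁.L))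
    (hex : ∃ U₂ U₁ T, S.IsAdaptedFrame P₂ P₁ U₂ U₁ T)
    (h : ∀ U₂ U₁ T, S.IsAdaptedFrame P₂ P₁ U₂ U₁ T → ∀ q q' X,
      (starRingEnd ℂ) (((w₂.σ q).1 X).1 U₂) * ((w₁.σ q').1 X).1 U₁ =
        if S.leaf (P₂.L ⊓ P₁.L) X = Λ q q' then M q q' else 0) :
    S.IsIntertwiner P₂ P₁ (S.intertwiner P₂ P₁) ∧
      ∀ q', S.intertwiner P₂ P₁ (w₁.σ q') = ∑ q, M q q' • w₂.σ q := by
  -- `adaptedFrame` is an unspecified choice, so existence of some adapted frame is what gives it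
  -- its properties; this is also why `h` quantifies over all of them.
  have hA : S.IsAdaptedFrame P₂ P₁ (S.adaptedFrame P₂ P₁).1 (S.adaptedFrame P₂ P₁).2.1
      (S.adaptedFrame P₂ P₁).2.2 := by
    obtain ⟨U₂, U₁, T, hA⟩ := hex
    exact Classical.epsilon_spec
      (p := fun F : (Fin g → P₂.L) × (Fin g → P₁.L) × (Fin g → V) =>
        S.IsAdaptedFrame P₂ P₁ F.1 F.2.1 F.2.2) ⟨(U₂, U₁, T), hA⟩
  have hbks : ∀ a b : (Fin g → ZMod S.k) → ℂ,
      S.bksPairing P₂ P₁ (∑ q, a q • w₂.σ q) (∑ q, b q • w₁.σ q) =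
        ∑ q, ∑ q', (starRingEnd ℂ) (a q) * b q' * M q q' := by
    intro a b
    rw [← Fintype.sum_prod_type']
    refine S.integral_eq_sum (fun j => hA.mem_inf j.2) _ (fun p => Λ p.1 p.2) fun X => ?_
    simp only [sum_apply, map_sum]
    rw [Fintype.sum_prod_type, Finset.sum_mul_sum]
    refine Finset.sum_congr rfl fun q _ => Finset.sum_congr rfl fun q' _ => ?_
    have h1 := h _ _ _ hA q q' X
    have h2 : (if S.leaf (P₂.L ⊓ P₁.L) X = Λ q q' then (starRingEnd ℂ) (a q) * b q' * M q q'
        else 0) = (starRingEnd ℂ) (a q) * b q' *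
          (if S.leaf (P₂.L ⊓ P₁.L) X = Λ q q' then M q q' else 0) := by
      rw [mul_ite, mul_zero]
    rw [h2, ← h1, map_mul]
    ring
  have hF : S.IsIntertwiner P₂ P₁ (w₁.σBasis.constr ℂ fun q' => ∑ q, M q q' • w₂.σ q) := by
    intro ψ₂ ψ₁
    obtain ⟨a, rfl⟩ := w₂.exists_sum ψ₂
    obtain ⟨b, rfl⟩ := w₁.exists_sum ψ₁
    have h1 : (w₁.σBasis.constr ℂ fun q' => ∑ q, M q q' • w₂.σ q) (∑ q', b q' • w₁.σ q') =
        ∑ q, (∑ q', b q' * M q q') • w₂.σ q := by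
      simp only [map_sum, map_smul, ← σBasis_apply w₁, Module.Basis.constr_basis,
        Finset.smul_sum, smul_smul, Finset.sum_smul]
      exact Finset.sum_comm
    rw [h1, hbks, innerH_sum]
    refine Finset.sum_congr rfl fun q _ => ?_
    rw [Finset.mul_sum]
    refine Finset.sum_congr rfl fun q' _ => ?_
    ring
  -- The operator with matrix M shows that an intertwiner exists, so the chosen one satisfies the
  -- defining identity. Nondegeneracy of the inner product then identifies the two.
  have hI : S.IsIntertwiner P₂ P₁ (S.intertwiner P₂ P₁) :=
    Classical.epsilon_spec ⟨_, hF⟩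
  refine ⟨hI, fun q' => w₂.eq_of_innerH fun q => ?_⟩
  rw [hI, ← hF, ← w₁.σBasis_apply, Module.Basis.constr_basis]

/-- An operator is unitary if its matrix in the standard basis is. -/
theorem isUnitary_of_matrix (A : S.H P →ₗ[ℂ] S.H P)
    (M : Matrix (Fin g → ZMod S.k) (Fin g → ZMod S.k) ℂ)
    (hA : ∀ q', A (w.σ q') = ∑ q, M q q' • w.σ q) (hM : Mᴴ * M = 1) : S.IsUnitary P A := by
  have hsum : ∀ b : (Fin g → ZMod S.k) → ℂ,
      A (∑ q, b q • w.σ q) = ∑ q, (M *ᵥ b) q • w.σ q := by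
    intro b
    simp only [map_sum, map_smul, hA, Finset.smul_sum, smul_smul, Matrix.mulVec, dotProduct,
      Finset.sum_smul]
    rw [Finset.sum_comm]
    simp only [mul_comm]
  have hinner : ∀ ψ φ, S.innerH P (A ψ) (A φ) = S.innerH P ψ φ := by
    intro ψ φ
    obtain ⟨a, rfl⟩ := w.exists_sum ψ
    obtain ⟨b, rfl⟩ := w.exists_sum φ
    rw [hsum, hsum, innerH_sum, innerH_sum]
    have h1 : star (M *ᵥ a) ⬝ᵥ (M *ᵥ b) = star a ⬝ᵥ b := by
      rw [Matrix.star_mulVec, ← Matrix.dotProduct_mulVec, Matrix.mulVec_mulVec, hM,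
        Matrix.one_mulVec]
    exact h1
  refine ⟨⟨fun ψ φ h => w.eq_of_innerH fun q => ?_, fun ψ => ?_⟩, hinner⟩
  · rw [← hinner, ← hinner (w.σ q) φ, h]
  · obtain ⟨b, rfl⟩ := w.exists_sum ψ
    refine ⟨∑ q, (Mᴴ *ᵥ b) q • w.σ q, ?_⟩
    -- M is a finite square matrix, so its left inverse is also a right inverse.
    rw [hsum, Matrix.mulVec_mulVec, mul_eq_one_comm.1 hM, Matrix.one_mulVec]

/-! ### Elements of Sp(Z) that preserve the Lagrangian subspace. -/

theorem isOver_iff (q : Fin g → ZMod S.k) (X : V) :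
    w.IsOver q X ↔ ∃ n : Fin g → ℤ, (∀ i, S.k * S.ω (w.W i) X = n i) ∧
      ∀ i, (n i : ZMod S.k) = q i := by
  refine ⟨fun h => ?_, fun ⟨n, h1, h2⟩ i => ⟨n i, h1 i, h2 i⟩⟩
  choose n h1 h2 using h
  exact ⟨n, h1, h2⟩

theorem map_L_eq {b : S.SpZ} (h : ∀ i, (b : V ≃ₗ[ℝ] V) (w.W i) ∈ P.L) : (P.map b).L = P.L := by
  have : FiniteDimensional ℝ V := w.basis.finiteDimensional_of_finite
  refine Submodule.eq_of_le_of_finrank_eq ?_ ?_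
  · change P.L.map ((b : V ≃ₗ[ℝ] V) : V →ₗ[ℝ] V) ≤ P.L
    rw [Submodule.map_le_iff_le_comap]
    conv_lhs => rw [← w.span_inl]
    rw [Submodule.span_le]
    rintro _ ⟨i, rfl⟩
    exact h i
  · rw [P.finrank_eq, (P.map b).finrank_eq]

theorem exists_adaptedFrame_of_L_eq (w : S.SymplecticBasis P) {P' : S.Polarization}
    (hL : P'.L = P.L) :
    ∃ U₂ U₁ T, S.IsAdaptedFrame P P' U₂ U₁ T := by
  have h0 : S.codim P P' = 0 := S.codim_of_L_eq hL
  have hk := k_ne_zero' (S := S)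
  -- The adapted frame is normalized for kω rather than ω, whence the factor k⁻¹ in T. The
  -- codimension is 0, so the conditions on V₂ and V₁ are vacuous.
  refine ⟨w.frame, fun i => LinearEquiv.ofEq _ _ hL.symm (w.frame i), fun j => (S.k : ℝ)⁻¹ • w.Wp j,
    ⟨w.frame.linearIndependent, ?_, fun j _ => rfl, ?_, fun i j _ _ => ?_, ?_, ?_, ?_⟩⟩
  · exact (w.frame.map (LinearEquiv.ofEq _ _ hL.symm)).linearIndependent
  · have h1 : {j : Fin g | S.codim P P' ≤ j} = Set.univ := by simp [h0]
    rw [h1, Set.image_univ, hL, inf_idem]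
    exact w.isLatticeFrame.span_eq
  · rw [w.frame_apply, map_smul, smul_eq_mul, mul_inv_cancel_left₀ hk, W, Wp, w.ω_inl_inr]
  all_goals
    intro i j hi
    simp [h0] at hi

open Classical in
/-- The operator that represents an element of `Sp(Z)` that preserves the Lagrangian subspace. -/
theorem U_of_map_L_eq {b : S.SpZ} (hL : (P.map b).L = P.L)
    (r : (Fin g → ZMod S.k) → (Fin g → ZMod S.k)) (hr : Function.Injective r)
    (c : (Fin g → ZMod S.k) → ℂ) (hc : ∀ q, ‖c q‖ = 1)
    (hover : ∀ q X, (w.map b).IsOver q X ↔ w.IsOver (r q) X)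
    (hK : ∀ q X, w.IsOver (r q) X →
      Complex.exp (2 * Real.pi * Complex.I * S.k * (w.K X - (w.map b).K X : ℝ)) = c q) :
    S.IsIntertwiner P (P.map b) (S.intertwiner P (P.map b)) ∧
      S.IsUnitary P (S.U P b) ∧ ∀ q, S.U P b (w.σ q) = c q • w.σ (r q) := by
  have hD : P.L ⊓ (P.map b).L = P.L := by rw [hL, inf_idem]
  obtain ⟨h1, h2⟩ := w.intertwiner_spec (w.map b) (fun q q' => if q = r q' then c q' else 0)
    (fun q _ => S.leaf _ (w.point q)) (w.exists_adaptedFrame_of_L_eq hL) (by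
      intro U₂ U₁ T hA q q' X
      -- Both frames are lattice frames, so both half-densities equal 1 and only the phases matter.
      obtain ⟨hl₂, hl₁⟩ := hA.isLatticeFrame hL
      have hleaf : S.leaf (P.L ⊓ (P.map b).L) X = S.leaf (P.L ⊓ (P.map b).L) (w.point q) ↔
          w.IsOver q X := by
        rw [w.isOver_iff_leaf, leaf_eq_iff, leaf_eq_iff, hD]
      simp only [σ_apply, w.δ_of_isLatticeFrame hl₂, (w.map b).δ_of_isLatticeFrame hl₁, hleaf,
        hover, mul_one]
      by_cases hq : w.IsOver q X
      · by_cases hq' : w.IsOver (r q') X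
        · obtain rfl := hq.unique hq'
          rw [if_pos hq, if_pos hq', if_pos hq, if_pos rfl, ← hK q' X hq', w.conj_exp,
            ← Complex.exp_add]
          congr 1
          push_cast
          ring
        · have hne : q ≠ r q' := fun h => hq' (h ▸ hq)
          rw [if_neg hq', if_neg hne, mul_zero, ite_self]
      · rw [if_neg hq, if_neg hq, map_zero, zero_mul])
  have h3 : ∀ q, S.U P b (w.σ q) = c q • w.σ (r q) := by
    intro q
    rw [U, LinearMap.comp_apply, act_σ, h2]
    simp
  refine ⟨h1, ?_, h3⟩
  -- The matrix has a single nonzero entry in each column, of modulus 1, and these entries lie in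
  -- distinct rows because r is injective.
  refine w.isUnitary_of_matrix _ (Matrix.of fun q q' => if q = r q' then c q' else 0) (fun q => ?_) ?_
  · rw [h3]
    simp
  · ext q q'
    simp only [Matrix.mul_apply, Matrix.conjTranspose_apply, Matrix.one_apply,
      Matrix.of_apply]
    rw [Finset.sum_eq_single (r q)]
    · by_cases h : q = q'
      · subst h
        simp only [if_true, Complex.star_def, Complex.conj_mul', hc]
        norm_num
      · have h' : r q ≠ r q' := fun e => h (hr e)
        simp [h, h']
    · intro p _ hp
      simp [hp]
    · simp

/-! ### Matrix action on the symplectic basis; the operators of α and β. -/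

theorem ofSymplectic_W (M : Matrix.symplecticGroup (Fin g) ℤ) (j : Fin g) :
    (w.ofSymplectic M : V ≃ₗ[ℝ] V) (w.W j) =
      ∑ i, M.1 (Sum.inl i) (Sum.inl j) • w.W i + ∑ i, M.1 (Sum.inr i) (Sum.inl j) • w.Wp i := by
  exact (w.ofMatrix_basis M.1 _).trans (Fintype.sum_sum_type _)

theorem ofSymplectic_Wp (M : Matrix.symplecticGroup (Fin g) ℤ) (j : Fin g) :
    (w.ofSymplectic M : V ≃ₗ[ℝ] V) (w.Wp j) =
      ∑ i, M.1 (Sum.inl i) (Sum.inr j) • w.W i + ∑ i, M.1 (Sum.inr i) (Sum.inr j) • w.Wp i := by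
  exact (w.ofMatrix_basis M.1 _).trans (Fintype.sum_sum_type _)

theorem α_W (A : GL (Fin g) ℤ) (j : Fin g) :
    (w.α A : V ≃ₗ[ℝ] V) (w.W j) = ∑ i, A.1 i j • w.W i := by
  rw [α, ofSymplectic_W]
  simp

theorem α_Wp (A : GL (Fin g) ℤ) (j : Fin g) :
    (w.α A : V ≃ₗ[ℝ] V) (w.Wp j) = ∑ i, (A⁻¹).1 j i • w.Wp i := by
  rw [α, ofSymplectic_Wp]
  simp

theorem β_W (B : Matrix (Fin g) (Fin g) ℤ) (hB : Bᵀ = B) (j : Fin g) :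
    (w.β B hB : V ≃ₗ[ℝ] V) (w.W j) = w.W j := by
  rw [β, ofSymplectic_W]
  simp [Matrix.one_apply]

theorem β_Wp (B : Matrix (Fin g) (Fin g) ℤ) (hB : Bᵀ = B) (j : Fin g) :
    (w.β B hB : V ≃ₗ[ℝ] V) (w.Wp j) = ∑ i, B i j • w.W i + w.Wp j := by
  rw [β, ofSymplectic_Wp]
  simp [Matrix.one_apply]

theorem γ_W (j : Fin g) : (w.γ : V ≃ₗ[ℝ] V) (w.W j) = -w.Wp j := by
  rw [γ, ofSymplectic_W]
  simp [Matrix.one_apply]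

theorem γ_Wp (j : Fin g) : (w.γ : V ≃ₗ[ℝ] V) (w.Wp j) = w.W j := by
  rw [γ, ofSymplectic_Wp]
  simp [Matrix.one_apply]

/-- Recovers the leaf conditions for the W_i from those for the vectors α W_i: the integer matrix C
inverts D over ℝ, and the same inversion can be reduced modulo k. -/
theorem mulVec_isOver {C D : Matrix (Fin g) (Fin g) ℤ} (hCD : C * D = 1)
    {q : Fin g → ZMod S.k} {x : Fin g → ℝ} {n : Fin g → ℤ}
    (hn : ∀ i, ∑ j, (D i j : ℝ) * x j = n i) (hq : ∀ i, (n i : ZMod S.k) = q i) (i : Fin g) :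
    x i = ((C *ᵥ n) i : ℤ) ∧
      (((C *ᵥ n) i : ℤ) : ZMod S.k) = (C.map (Int.cast : ℤ → ZMod S.k) *ᵥ q) i := by
  constructor
  · have h1 : (C.map (Int.cast : ℤ → ℝ)) * D.map (Int.cast : ℤ → ℝ) = 1 := by
      rw [← Matrix.map_mul_intCast, hCD]
      simp [Matrix.map_one]
    have h2 : (D.map (Int.cast : ℤ → ℝ)) *ᵥ x = fun i => (n i : ℝ) := funext hn
    have h3 := congrArg (fun y => (C.map (Int.cast : ℤ → ℝ) *ᵥ y) i) h2
    simp only [Matrix.mulVec_mulVec, h1, Matrix.one_mulVec] at h3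
    rw [h3]
    simp [Matrix.mulVec, dotProduct]
  · simp [Matrix.mulVec, dotProduct, hq]

/-- The vectors x and y transform by ᵗA and A⁻¹, so their dot product 2K is unchanged and no phase
appears. The leaf of α P labelled q satisfies ᵗA(kx) ≡ q, which is the leaf of P labelled ᵗA⁻¹q. -/
theorem U_α (A : GL (Fin g) ℤ) :
    S.IsIntertwiner P (P.map (w.α A)) (S.intertwiner P (P.map (w.α A))) ∧
      S.IsUnitary P (S.U P (w.α A)) ∧
      ∀ q : Fin g → ZMod S.k,
        S.U P (w.α A) (w.σ q) = w.σ (((A⁻¹).1ᵀ.map (Int.cast : ℤ → ZMod S.k)) *ᵥ q) := by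
  have hA : A.1 * (A⁻¹).1 = 1 := A.mul_inv
  have hA₁ : (A⁻¹).1ᵀ * A.1ᵀ = 1 := by rw [← Matrix.transpose_mul, hA, Matrix.transpose_one]
  have hA₂ : A.1ᵀ * (A⁻¹).1ᵀ = 1 := mul_eq_one_comm.1 hA₁
  have hmap : A.1ᵀ.map (Int.cast : ℤ → ZMod S.k) * (A⁻¹).1ᵀ.map (Int.cast : ℤ → ZMod S.k) = 1 := by
    rw [← Matrix.map_mul_intCast, hA₂]
    simp [Matrix.map_one]
  have hL : (P.map (w.α A)).L = P.L := w.map_L_eq fun i => by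
    rw [α_W]
    exact P.L.sum_mem fun j _ => by
      rw [← Int.cast_smul_eq_zsmul ℝ]
      exact P.L.smul_mem _ (w.W_mem_L j)
  have hω : ∀ i X, S.ω ((w.map (w.α A)).W i) X = ∑ j, (A.1ᵀ i j : ℝ) * S.ω (w.W j) X := by
    intro i X
    rw [map_W, α_W]
    simp
  have hω' : ∀ i X, S.ω X ((w.map (w.α A)).Wp i) = ∑ j, ((A⁻¹).1 i j : ℝ) * S.ω X (w.Wp j) := by
    intro i X
    rw [map_Wp, α_Wp]
    simp
  have hK : ∀ X, (w.map (w.α A)).K X = w.K X := by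
    intro X
    have h1 : (fun i => S.ω ((w.map (w.α A)).W i) X) =
        (A.1.map (Int.cast : ℤ → ℝ))ᵀ *ᵥ fun i => S.ω (w.W i) X := funext fun i => hω i X
    have h2 : (fun i => S.ω X ((w.map (w.α A)).Wp i)) =
        ((A⁻¹).1.map (Int.cast : ℤ → ℝ)) *ᵥ fun i => S.ω X (w.Wp i) := funext fun i => hω' i X
    have h3 : (fun i => S.ω ((w.map (w.α A)).W i) X) ⬝ᵥ (fun i => S.ω X ((w.map (w.α A)).Wp i)) =
        (fun i => S.ω (w.W i) X) ⬝ᵥ (fun i => S.ω X (w.Wp i)) := by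
      rw [h1, h2, Matrix.mulVec_transpose, ← Matrix.dotProduct_mulVec, Matrix.mulVec_mulVec,
        ← Matrix.map_mul_intCast, hA]
      simp [Matrix.map_one]
    exact congrArg (fun x => 1 / 2 * x) h3
  have h := w.U_of_map_L_eq hL (fun q => ((A⁻¹).1ᵀ.map (Int.cast : ℤ → ZMod S.k)) *ᵥ q)
    (fun q q' hq => by
      have h1 := congrArg (fun y => A.1ᵀ.map (Int.cast : ℤ → ZMod S.k) *ᵥ y) hq
      simpa only [Matrix.mulVec_mulVec, hmap, Matrix.one_mulVec] using h1)
    (fun _ => 1) (fun _ => by simp)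
    (fun q X => by
      constructor
      · intro h
        obtain ⟨n, hn, hq⟩ := ((w.map (w.α A)).isOver_iff q X).1 h
        have h1 : ∀ i, ∑ j, (A.1ᵀ i j : ℝ) * (S.k * S.ω (w.W j) X) = n i := fun i => by
          rw [← hn, hω, Finset.mul_sum]
          exact Finset.sum_congr rfl fun j _ => by ring
        exact fun i => ⟨_, mulVec_isOver hA₁ h1 hq i⟩
      · intro h
        obtain ⟨n, hn, hq⟩ := (w.isOver_iff _ X).1 h
        refine fun i => ⟨(A.1ᵀ *ᵥ n) i, ?_, ?_⟩
        · rw [hω, Finset.mul_sum]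
          simp only [Matrix.mulVec, dotProduct, Int.cast_sum, Int.cast_mul, ← hn]
          exact Finset.sum_congr rfl fun j _ => by ring
        · have h1 : (fun i => (n i : ZMod S.k)) = _ := funext hq
          have h2 := congrArg (fun y => (A.1ᵀ.map (Int.cast : ℤ → ZMod S.k) *ᵥ y) i) h1
          simp only [Matrix.mulVec_mulVec, hmap, Matrix.one_mulVec] at h2
          rw [← h2]
          simp [Matrix.mulVec, dotProduct])
    (fun q X _ => by simp [hK])
  simpa using h

/-- The Gauss phases `e^{(π i / k) ᵗq B q}` depend on `q` modulo `k` only. -/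
theorem exp_quadratic_eq {B : Matrix (Fin g) (Fin g) ℤ} (hB : Bᵀ = B) {m n : Fin g → ℤ}
    (h : ∀ i, (m i : ZMod S.k) = n i) :
    Complex.exp (Real.pi * Complex.I / S.k * ((m ⬝ᵥ B *ᵥ m : ℤ) : ℂ)) =
      Complex.exp (Real.pi * Complex.I / S.k * ((n ⬝ᵥ B *ᵥ n : ℤ) : ℂ)) := by
  have hl : ∀ i, ∃ l : ℤ, m i = n i + S.k * l := fun i => by
    obtain ⟨l, hl⟩ := (ZMod.intCast_eq_intCast_iff_dvd_sub _ _ _).1 (h i).symm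
    exact ⟨l, by omega⟩
  choose l hl using hl
  obtain ⟨r, hr⟩ := S.k_even
  have hm : m = n + (S.k : ℤ) • l := by
    funext i
    simp [hl]
  have hsymm : n ⬝ᵥ B *ᵥ l = l ⬝ᵥ B *ᵥ n := by
    rw [Matrix.dotProduct_mulVec, ← Matrix.mulVec_transpose, hB, dotProduct_comm]
  -- With m = n + k l, symmetry of B doubles the cross term to 2k ᵗl B n, and evenness of k makes k²
  -- ᵗl B l a multiple of 2k.
  have hq : m ⬝ᵥ B *ᵥ m =
      n ⬝ᵥ B *ᵥ n + S.k * (2 * (l ⬝ᵥ B *ᵥ n + r * (l ⬝ᵥ B *ᵥ l))) := by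
    have hk : (S.k : ℤ) = r + r := by exact_mod_cast hr
    rw [hm, Matrix.mulVec_add, Matrix.mulVec_smul, add_dotProduct, dotProduct_add, dotProduct_add,
      smul_dotProduct, smul_dotProduct, dotProduct_smul, dotProduct_smul, hsymm]
    simp only [smul_eq_mul]
    rw [hk]
    ring
  have hk : (S.k : ℂ) ≠ 0 := Nat.cast_ne_zero.2 S.k_pos.ne'
  rw [hq, Complex.exp_eq_exp_iff_exists_int]
  refine ⟨l ⬝ᵥ B *ᵥ n + r * (l ⬝ᵥ B *ᵥ l), ?_⟩
  push_cast
  field_simp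

/-- β fixes every W_i, hence all leaf labels, and replaces y by y - Bx. The change of potential is ½
ᵗx B x with x = n/k, and multiplication by 2πik gives (πi/k) ᵗn B n. -/
theorem U_β (B : Matrix (Fin g) (Fin g) ℤ) (hB : Bᵀ = B) :
    S.IsIntertwiner P (P.map (w.β B hB)) (S.intertwiner P (P.map (w.β B hB))) ∧
      S.IsUnitary P (S.U P (w.β B hB)) ∧
      ∀ q : Fin g → ℤ,
        S.U P (w.β B hB) (w.σ fun i => (q i : ZMod S.k)) =
          Complex.exp (Real.pi * Complex.I / S.k * ((q ⬝ᵥ B *ᵥ q : ℤ) : ℂ)) •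
            w.σ fun i => (q i : ZMod S.k) := by
  have hk : (S.k : ℂ) ≠ 0 := Nat.cast_ne_zero.2 S.k_pos.ne'
  have hL : (P.map (w.β B hB)).L = P.L := w.map_L_eq fun i => by
    rw [β_W]
    exact w.W_mem_L i
  have hKsub : ∀ X, w.K X - (w.map (w.β B hB)).K X =
      1 / 2 * ∑ i, S.ω (w.W i) X * ∑ j, (B i j : ℝ) * S.ω (w.W j) X := by
    intro X
    simp only [K, map_W, map_Wp, β_W, β_Wp]
    rw [← mul_sub, ← Finset.sum_sub_distrib]
    congr 1
    refine Finset.sum_congr rfl fun i _ => ?_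
    have h1 : S.ω X (∑ j, B j i • w.W j + w.Wp i) =
        S.ω X (w.Wp i) - ∑ j, (B i j : ℝ) * S.ω (w.W j) X := by
      rw [map_add, map_sum, add_comm, sub_eq_add_neg, ← Finset.sum_neg_distrib]
      congr 1
      refine Finset.sum_congr rfl fun j _ => ?_
      rw [map_zsmul, ← LinearMap.IsAlt.neg S.ω_alt, show B j i = B i j from congrFun₂ hB i j]
      simp
    rw [h1]
    ring
  obtain ⟨h1, h2, h3⟩ := w.U_of_map_L_eq hL id Function.injective_id
    (fun q => Complex.exp (Real.pi * Complex.I / S.k *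
      (((fun i => ((q i).val : ℤ)) ⬝ᵥ B *ᵥ (fun i => ((q i).val : ℤ)) : ℤ) : ℂ)))
    (fun q => by
      rw [show ∀ m : ℤ, (Real.pi * Complex.I / S.k * (m : ℂ) : ℂ) =
        ((Real.pi / S.k * m : ℝ) : ℂ) * Complex.I from fun m => by push_cast; ring]
      exact Complex.norm_exp_ofReal_mul_I _)
    (fun q X => by simp only [IsOver, map_W, β_W, id])
    -- The coefficient was defined through the representatives in [0, k); `exp_quadratic_eq`
    -- replaces them by the integers n_i = k ω(W_i, X).
    (fun q X hX => by
      obtain ⟨n, hn, hq⟩ := (w.isOver_iff _ X).1 hX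
      rw [exp_quadratic_eq hB (n := n) fun i => by simp [hq], hKsub]
      congr 1
      have h4 : (S.k : ℝ) ^ 2 * ∑ i, S.ω (w.W i) X * ∑ j, (B i j : ℝ) * S.ω (w.W j) X =
          ((n ⬝ᵥ B *ᵥ n : ℤ) : ℝ) := by
        simp only [Matrix.mulVec, dotProduct, Int.cast_sum, Int.cast_mul, ← hn, Finset.mul_sum]
        exact Finset.sum_congr rfl fun i _ => Finset.sum_congr rfl fun j _ => by ring
      have h5 := congrArg (fun x : ℝ => (x : ℂ)) h4
      simp only [Complex.ofReal_mul, Complex.ofReal_pow, Complex.ofReal_natCast,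
        Complex.ofReal_intCast] at h5
      rw [← h5, Complex.ofReal_mul]
      push_cast
      field_simp)
  refine ⟨h1, h2, fun q => ?_⟩
  rw [h3]
  congr 1
  exact exp_quadratic_eq hB fun i => by simp

/-! ### The element γ: transverse polarizations and the finite Fourier transform. -/

theorem ω_map_γ_W (i : Fin g) (X : V) : S.ω ((w.map w.γ).W i) X = S.ω X (w.Wp i) := by
  rw [map_W, γ_W, map_neg, LinearMap.neg_apply, LinearMap.IsAlt.neg S.ω_alt]

theorem ω_map_γ_Wp (i : Fin g) (X : V) : S.ω X ((w.map w.γ).Wp i) = -S.ω (w.W i) X := by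
  rw [map_Wp, γ_Wp, LinearMap.IsAlt.neg S.ω_alt]

/-- A vector of P has all x_i = 0, and a vector of γ P has all y_i = 0 because γ W_i = -W_i^⊥. -/
theorem inf_map_γ : P.L ⊓ (P.map w.γ).L = ⊥ := by
  rw [eq_bot_iff]
  rintro X ⟨h1, h2⟩
  have h3 : ∀ i, S.ω X (w.Wp i) = 0 := fun i => by
    rw [← ω_map_γ_W]
    exact (P.map w.γ).isotropic _ ((w.map w.γ).W_mem_L i) _ h2
  rw [Submodule.mem_bot, w.expand X]
  simp [h3, P.isotropic _ (w.W_mem_L _) X h1]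

theorem codim_γ : S.codim P (P.map w.γ) = g := by
  rw [codim, inf_map_γ, finrank_bot, Nat.sub_zero]

theorem exists_adaptedFrame_γ : ∃ U₂ U₁ T, S.IsAdaptedFrame P (P.map w.γ) U₂ U₁ T := by
  have h0 := w.codim_γ
  have hk := k_ne_zero' (S := S)
  have hk' : IsUnit (-(S.k : ℝ)⁻¹) := by simpa using hk
  have hno : ∀ j : Fin g, ¬ S.codim P (P.map w.γ) ≤ j := fun j => by
    rw [h0]
    exact j.2.not_ge
  -- The second frame is k⁻¹ W_i^⊥ = -k⁻¹ γ W_i, dual to W_i for kω. The codimension is g, so no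
  -- index belongs to W or T, and T = 0 serves.
  refine ⟨w.frame, fun i => -(S.k : ℝ)⁻¹ • (w.map w.γ).frame i, 0,
    ⟨w.frame.linearIndependent, ?_, fun j hj => absurd hj (hno j), ?_,
      fun i j hi => absurd hi (hno i), ?_, fun i j _ hj => absurd hj (hno j),
      fun i j _ hj => absurd hj (hno j)⟩⟩
  · convert ((w.map w.γ).frame.isUnitSMul (fun _ => hk')).linearIndependent using 1
    funext i
    rw [Module.Basis.isUnitSMul_apply]
  · have h1 : {j : Fin g | S.codim P (P.map w.γ) ≤ j} = ∅ := Set.eq_empty_of_forall_notMem hno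
    rw [h1, Set.image_empty, Submodule.span_empty, inf_map_γ]
    ext X
    simp only [Submodule.mem_bot, Submodule.mem_inf, Submodule.restrictScalars_mem]
    exact ⟨fun h => ⟨h ▸ S.Z.zero_mem, h⟩, fun h => h.2⟩
  · intro i j _ _
    rw [Submodule.coe_smul, frame_apply, frame_apply, map_smul, map_W, γ_W, map_neg, W, Wp,
      w.ω_inl_inr, smul_neg, smul_eq_mul]
    split_ifs <;> field_simp

/-- The value of the product of half-densities on an adapted frame. -/
theorem δ_mul_δ_γ {U₂ : Fin g → P.L} {U₁ : Fin g → (P.map w.γ).L} {T : Fin g → V}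
    (h : S.IsAdaptedFrame P (P.map w.γ) U₂ U₁ T) :
    w.δ.1 U₂ * (w.map w.γ).δ.1 U₁ = (((S.k : ℝ) ^ (-(g : ℝ) / 2) : ℝ) : ℂ) := by
  have hk : (0 : ℝ) < S.k := Nat.cast_pos.2 S.k_pos
  -- The duality kω(U₂ i, U₁ j) = δ_ij in coordinates. Taking determinants gives k^g |det U₂| |det
  -- U₁| = 1, and half-densities take the square root.
  have h1 : (-(S.k : ℝ)) • ((w.frame.toMatrix U₂)ᵀ * (w.map w.γ).frame.toMatrix U₁) = 1 := by
    ext i j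
    have h2 := h.V₂_V₁ i j (by rw [codim_γ]; exact i.2) (by rw [codim_γ]; exact j.2)
    have h3 : ∀ l, S.ω (w.W l) (U₂ i) = 0 := fun l => P.isotropic _ (w.W_mem_L l) _ (U₂ i).2
    rw [w.ω_expand] at h2
    simp only [h3, zero_mul, sub_zero] at h2
    rw [Matrix.one_apply, ← h2]
    simp [Matrix.mul_apply, Module.Basis.toMatrix_apply, frame_repr, ω_map_γ_Wp]
  have h4 := congrArg (fun M => |Matrix.det M|) h1
  simp only [Matrix.det_smul, Matrix.det_mul, Matrix.det_transpose, Matrix.det_one, abs_mul,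
    abs_pow, abs_neg, abs_one, Fintype.card_fin, ← Module.Basis.det_apply, abs_of_pos hk] at h4
  have h5 : |w.frame.det U₂| * |(w.map w.γ).frame.det U₁| = (S.k : ℝ) ^ (-(g : ℝ)) := by
    rw [Real.rpow_neg hk.le, Real.rpow_natCast]
    exact eq_inv_of_mul_eq_one_right h4
  simp only [δ]
  rw [← Complex.ofReal_mul, ← Real.sqrt_mul (abs_nonneg _), h5, Real.sqrt_eq_rpow,
    ← Real.rpow_mul hk.le]
  congr 2
  ring

/-- The point over the leaf `Λ_q` of `P` and over the image under `γ` of the leaf `Λ_q'`. -/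
def pointγ (q q' : Fin g → ZMod S.k) : V :=
  ∑ i, (((q' i).val : ℝ) / S.k) • w.W i + ∑ i, (((q i).val : ℝ) / S.k) • w.Wp i

/-- As P and γ P are transverse, a translate of their intersection is one point of the torus. The
two label conditions fix every x_i and y_i modulo ℤ, hence X modulo Z. -/
theorem isOver_pointγ_iff (q q' : Fin g → ZMod S.k) (X : V) :
    S.leaf (P.L ⊓ (P.map w.γ).L) X = S.leaf _ (w.pointγ q q') ↔
      w.IsOver q X ∧ (w.map w.γ).IsOver q' X := by
  have hk := k_ne_zero' (S := S)
  have h1 : ∀ i, S.ω (w.W i) (w.pointγ q q') = ((q i).val : ℝ) / S.k := fun i => by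
    simp [pointγ, W, Wp, w.ω_inl_inr, w.ω_inl_inl]
  have h2 : ∀ i, S.ω (w.pointγ q q') (w.Wp i) = ((q' i).val : ℝ) / S.k := fun i => by
    simp [pointγ, W, Wp, w.ω_inl_inr, w.ω_inr_inr]
  rw [leaf_eq_iff, inf_map_γ]
  constructor
  · rintro ⟨W, hW, U, hU, h⟩
    rw [Submodule.mem_bot] at hU
    rw [hU, add_zero] at h
    rw [← w.isOver_add_Z_iff q hW, ← (w.map w.γ).isOver_add_Z_iff q' hW, h]
    refine ⟨fun i => ⟨(q i).val, ?_, by simp⟩, fun i => ⟨(q' i).val, ?_, by simp⟩⟩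
    · rw [h1, mul_div_cancel₀ _ hk]
      simp
    · rw [ω_map_γ_W, h2, mul_div_cancel₀ _ hk]
      simp
  · have hl : ∀ (a : ZMod S.k) (x : ℝ) (n : ℤ), S.k * x = n → (n : ZMod S.k) = a →
        ∃ l : ℤ, (a.val : ℝ) / S.k - x = l := by
      intro a x n hx hn
      obtain ⟨l, hl⟩ := (ZMod.intCast_eq_intCast_iff_dvd_sub n (a.val : ℤ) S.k).1 (by simp [hn])
      refine ⟨l, ?_⟩
      have h3 : ((a.val : ℤ) : ℝ) - n = S.k * l := by exact_mod_cast hl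
      rw [← hx] at h3
      push_cast at h3
      field_simp
      linarith
    rintro ⟨hq, hq'⟩
    refine ⟨w.pointγ q q' - X, ?_, 0, Submodule.zero_mem _, by abel⟩
    rw [w.expand (w.pointγ q q' - X)]
    refine S.Z.add_mem (S.Z.sum_mem fun i _ => ?_) (S.Z.sum_mem fun i _ => ?_)
    · obtain ⟨n, hn, hn'⟩ := hq' i
      rw [ω_map_γ_W] at hn
      obtain ⟨l, hl⟩ := hl _ _ _ hn hn'
      rw [map_sub, LinearMap.sub_apply, h2, hl, Int.cast_smul_eq_zsmul]
      exact S.Z.smul_mem _ (w.W_mem_Z i)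
    · obtain ⟨n, hn, hn'⟩ := hq i
      obtain ⟨l, hl⟩ := hl _ _ _ hn hn'
      rw [map_sub, h1, hl, Int.cast_smul_eq_zsmul]
      exact S.Z.smul_mem _ (w.Wp_mem_Z i)

theorem stdAddChar_sum (a : Fin g → ZMod S.k) :
    (ZMod.stdAddChar (∑ i, a i) : ℂ) = ∏ i, ZMod.stdAddChar (a i) :=
  map_prod (ZMod.stdAddChar (N := S.k)).toMonoidHom (fun i => Multiplicative.ofAdd (a i)) _

/-- Passes from the representatives `val` to characters of ℤ/k, where orthogonality is available. -/
theorem exp_dotProduct_eq (q q' : Fin g → ZMod S.k) :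
    Complex.exp (2 * Real.pi * Complex.I / S.k * ((∑ i, (q i).val * (q' i).val : ℕ) : ℂ)) =
      ∏ i, ZMod.stdAddChar (q i * q' i) := by
  rw [← stdAddChar_sum]
  have h1 : (∑ i, q i * q' i : ZMod S.k) = (((∑ i, (q i).val * (q' i).val : ℕ) : ℤ) : ZMod S.k) := by
    simp
  rw [h1, ZMod.stdAddChar_coe]
  congr 1
  push_cast
  ring

/-- The sum over p factors into sums over the coordinates p_i; each is k or 0 according to whether
q_i = q'_i, since the standard character is primitive. -/
theorem sum_prod_stdAddChar (q q' : Fin g → ZMod S.k) :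
    ∑ p : Fin g → ZMod S.k, (starRingEnd ℂ) (∏ i, ZMod.stdAddChar (q i * p i)) *
      ∏ i, ZMod.stdAddChar (q' i * p i) = if q = q' then (S.k : ℂ) ^ g else 0 := by
  have h1 : ∀ p : Fin g → ZMod S.k, (starRingEnd ℂ) (∏ i, ZMod.stdAddChar (q i * p i)) *
      ∏ i, ZMod.stdAddChar (q' i * p i) =
        ∏ i, (ZMod.stdAddChar (p i * (q' i - q i)) : ℂ) := by
    intro p
    rw [map_prod, ← Finset.prod_mul_distrib]
    refine Finset.prod_congr rfl fun i _ => ?_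
    rw [← AddChar.map_neg_eq_conj, ← AddChar.map_add_eq_mul]
    congr 1
    ring
  simp only [h1]
  rw [← Fintype.piFinset_univ, ← Finset.prod_univ_sum (fun _ => Finset.univ)
    fun i x => (ZMod.stdAddChar (x * (q' i - q i)) : ℂ)]
  simp only [AddChar.sum_mulShift _ (ZMod.isPrimitive_stdAddChar S.k), ZMod.card]
  split_ifs with h
  · subst h
    simp
  · obtain ⟨i, hi⟩ := Function.ne_iff.1 h
    refine Finset.prod_eq_zero (Finset.mem_univ i) ?_
    rw [if_neg (sub_ne_zero.2 (Ne.symm hi)), Nat.cast_zero]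

open Classical in
theorem U_γ :
    S.IsIntertwiner P (P.map w.γ) (S.intertwiner P (P.map w.γ)) ∧
      S.IsUnitary P (S.U P w.γ) ∧
      ∀ q : Fin g → ZMod S.k,
        S.U P w.γ (w.σ q) =
          (((S.k : ℝ) ^ (-(g : ℝ) / 2) : ℝ) : ℂ) • ∑ q₁ : Fin g → ZMod S.k,
            Complex.exp (2 * Real.pi * Complex.I / S.k *
              ((∑ i, (q i).val * (q₁ i).val : ℕ) : ℂ)) • w.σ q₁ := by
  have hk : (0 : ℝ) < S.k := Nat.cast_pos.2 S.k_pos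
  have hk' : (S.k : ℂ) ≠ 0 := Nat.cast_ne_zero.2 S.k_pos.ne'
  set c : ℝ := (S.k : ℝ) ^ (-(g : ℝ) / 2) with hc
  -- γ exchanges x_i and y_i with one change of sign, so the phases of the two sections add up to
  -- e^{4πikK} instead of cancelling.
  have hK : ∀ X, (w.map w.γ).K X = -w.K X := fun X => by
    simp only [K, ω_map_γ_W, ω_map_γ_Wp, mul_neg, Finset.sum_neg_distrib]
    simp only [mul_comm]
  obtain ⟨h1, h2⟩ := w.intertwiner_spec (w.map w.γ)
    (fun q q' => c * ∏ i, ZMod.stdAddChar (q' i * q i))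
    (fun q q' => S.leaf _ (w.pointγ q q')) w.exists_adaptedFrame_γ (by
      intro U₂ U₁ T hA q q' X
      simp only [isOver_pointγ_iff]
      rw [σ_apply, σ_apply]
      by_cases hq : w.IsOver q X
      · by_cases hq' : (w.map w.γ).IsOver q' X
        · rw [if_pos hq, if_pos hq', if_pos ⟨hq, hq'⟩, hc, ← w.δ_mul_δ_γ hA, map_mul, w.conj_exp,
            hK]
          have hδ : (starRingEnd ℂ) (w.δ.1 U₂) = w.δ.1 U₂ := Complex.conj_ofReal _
          have hphase : Complex.exp (2 * Real.pi * Complex.I * S.k * (w.K X : ℝ)) *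
              Complex.exp (-(2 * Real.pi * Complex.I * S.k * (-w.K X : ℝ))) =
                ∏ i, ZMod.stdAddChar (q' i * q i) := by
            obtain ⟨n, hn, hnq⟩ := (w.isOver_iff q X).1 hq
            obtain ⟨m, hm, hmq⟩ := ((w.map w.γ).isOver_iff q' X).1 hq'
            simp only [ω_map_γ_W] at hm
            have h3 : (∑ i, q' i * q i : ZMod S.k) = ((∑ i, m i * n i : ℤ) : ZMod S.k) := by
              simp [hnq, hmq]
            rw [← stdAddChar_sum, h3, ZMod.stdAddChar_coe, ← Complex.exp_add]
            congr 1
            have h4 : (S.k : ℝ) ^ 2 * (2 * w.K X) = ((∑ i, m i * n i : ℤ) : ℝ) := by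
              simp only [K, Int.cast_sum, Int.cast_mul, ← hn, ← hm, Finset.mul_sum]
              exact Finset.sum_congr rfl fun i _ => by ring
            have h5 := congrArg (fun x : ℝ => (x : ℂ)) h4
            simp only [Complex.ofReal_mul, Complex.ofReal_pow, Complex.ofReal_natCast,
              Complex.ofReal_intCast, Complex.ofReal_ofNat] at h5
            rw [← h5]
            push_cast
            field_simp
            ring
          rw [← hphase, hδ]
          ring
        · rw [if_neg hq', if_neg (mt And.right hq'), mul_zero]
      · rw [if_neg hq, if_neg (mt And.left hq), map_zero, zero_mul])
  have h3 : ∀ q, S.U P w.γ (w.σ q) = ∑ q₁, (c * ∏ i, ZMod.stdAddChar (q i * q₁ i) : ℂ) • w.σ q₁ := by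
    intro q
    rw [U, LinearMap.comp_apply, act_σ, h2]
  refine ⟨h1, w.isUnitary_of_matrix _
    (Matrix.of fun q₁ q => (c * ∏ i, ZMod.stdAddChar (q i * q₁ i) : ℂ)) h3 ?_, fun q => ?_⟩
  · have hcc : (c : ℂ) * c * (S.k : ℂ) ^ g = 1 := by
      have h4 : c * c * (S.k : ℝ) ^ g = 1 := by
        rw [hc, ← Real.rpow_add hk, ← Real.rpow_natCast, ← Real.rpow_add hk]
        ring_nf
        simp
      exact_mod_cast h4
    ext q q'
    simp only [Matrix.mul_apply, Matrix.conjTranspose_apply, Matrix.of_apply, Matrix.one_apply]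
    have h4 : ∀ p : Fin g → ZMod S.k,
        star (c * ∏ i, ZMod.stdAddChar (q i * p i) : ℂ) * (c * ∏ i, ZMod.stdAddChar (q' i * p i)) =
          c * c * ((starRingEnd ℂ) (∏ i, ZMod.stdAddChar (q i * p i)) *
            ∏ i, ZMod.stdAddChar (q' i * p i)) := by
      intro p
      rw [Complex.star_def, map_mul, Complex.conj_ofReal]
      ring
    simp only [h4]
    rw [← Finset.mul_sum, sum_prod_stdAddChar, mul_ite, mul_zero, hcc]
  · simp only [h3, Finset.smul_sum, smul_smul, exp_dotProduct_eq]

end SymplecticBasis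

end SymplecticTorus

end TorusQuantization

end

/-- The `IsIntertwiner` clauses carry the well-definedness: `intertwiner` is a choice, and they say
that the chosen operator really represents the pairing. -/
theorem propositionp {g : ℕ} {V : Type*} [AddCommGroup V] [Module ℝ V]
    (S : TorusQuantization.SymplecticTorus g V) (P : S.Polarization) (w : S.SymplecticBasis P) :
    -- the vectors `σ_q` form a unitary basis of `H_P`
    ((∀ q q', S.innerH P (w.σ q) (w.σ q') = if q = q' then 1 else 0) ∧
      LinearIndependent ℂ w.σ ∧ Submodule.span ℂ (Set.range w.σ) = ⊤) ∧
    -- the element `α`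
    (∀ A : Matrix.GeneralLinearGroup (Fin g) ℤ,
      S.IsIntertwiner P (P.map (w.α A)) (S.intertwiner P (P.map (w.α A))) ∧
      S.IsUnitary P (S.U P (w.α A)) ∧
      ∀ q : Fin g → ZMod S.k,
        S.U P (w.α A) (w.σ q) =
          w.σ (((A⁻¹).1ᵀ.map (Int.cast : ℤ → ZMod S.k)) *ᵥ q)) ∧
    -- the element `β`
    (∀ (B : Matrix (Fin g) (Fin g) ℤ) (hB : Bᵀ = B),
      S.IsIntertwiner P (P.map (w.β B hB)) (S.intertwiner P (P.map (w.β B hB))) ∧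
      S.IsUnitary P (S.U P (w.β B hB)) ∧
      ∀ q : Fin g → ℤ,
        S.U P (w.β B hB) (w.σ fun i => (q i : ZMod S.k)) =
          Complex.exp (Real.pi * Complex.I / S.k * ((q ⬝ᵥ B *ᵥ q : ℤ) : ℂ)) •
            w.σ fun i => (q i : ZMod S.k)) ∧
    -- the element `γ`
    (S.IsIntertwiner P (P.map w.γ) (S.intertwiner P (P.map w.γ)) ∧
      S.IsUnitary P (S.U P w.γ) ∧
      ∀ q : Fin g → ZMod S.k,
        S.U P w.γ (w.σ q) =
          (((S.k : ℝ) ^ (-(g : ℝ) / 2) : ℝ) : ℂ) • ∑ q₁ : Fin g → ZMod S.k,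
            Complex.exp (2 * Real.pi * Complex.I / S.k *
              ((∑ i, (q i).val * (q₁ i).val : ℕ) : ℂ)) • w.σ q₁) :=
  ⟨⟨w.innerH_σ, w.linearIndependent_σ, w.span_σ⟩, w.U_α, w.U_β, w.U_γ⟩
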